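/- There is a universal constant $C>0$ such that the following holds. Let $H$ be a Hermitian matrix on a finite-dimensional Hilbert space of positive dimension, let $\beta\ge 0$ and $T>0$, and let $\rho_\beta=e^{-\beta H}/\mathrm{Tr}(e^{-\beta H})$ be the Gibbs state. Let $\{A^a\}_{a\in A}$ be a finite family of matrices (jump operators) that is closed under adjoints, counted with multiplicity (there is a permutation $\sigma$ of the index set with $A^{\sigma(a)}=(A^a)^\dagger$ for all $a$), and normalized in operator norm by $\|\sum_{a}A^{a\dagger}A^a\|\le 1$. Let $\gamma:\mathbb R\to[0,1]$ be a measurable function satisfying the KMS condition $\gamma(\omega)=e^{-\beta\omega}\gamma(-\omega)$ for all $\omega\in\mathbb R$. With $A^a(t)=e^{iHt}A^ae^{-iHt}$ and the uniform window $f(t)=\mathbb 1(|t|\le T/2)/\sqrt T$, put $$\hat A^a(\omega)=\frac1{\sqrt{2\pi}}\int_{-\infty}^{\infty}e^{-i\omega t}f(t)A^a(t)\,dt$$ and let $$\mathcal L[\rho]=\sum_{a\in A}\int_{-\infty}^{\infty}\gamma(\omega)\Big(\hat A^a(\omega)\rho\hat A^a(\omega)^\dagger-\tfrac12\{\hat A^a(\omega)^\dagger\hat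 A^a(\omega),\rho\}\Big)d\omega$$ be the dissipative part of the coarse-grained master equation. Suppose that the mixing time $t_{mix}(\mathcal L)$ is finite, where $t_{mix}(\mathcal L)$ is the shortest time $t\ge 0$ for which $\|e^{\mathcal Lt}[\rho-\rho']\|_1\le\frac12\|\rho-\rho'\|_1$ for all states $\rho,\rho'$, and $\|\cdot\|_1$ is the trace norm. Then there is exactly one state $\rho_{fix}(\mathcal L)$ with $e^{\mathcal Lt}[\rho_{fix}(\mathcal L)]=\rho_{fix}(\mathcal L)$ for all $t\ge0$, and $$\|\rho_{fix}(\mathcal L)-\rho_\beta\|_1\le C\,\sqrt{\frac{\beta}{T}}\;t_{mix}(\mathcal L).$$ -/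

import Mathlib

open scoped Matrix.Norms.L2Operator ComplexOrder

noncomputable section

namespace OpenSystem

variable {n ι : Type*} [Fintype n] [DecidableEq n] [Fintype ι]

/-- A quantum state (density matrix): positive semidefinite with unit trace. -/
def IsState (ρ : Matrix n n ℂ) : Prop :=
  ρ.PosSemidef ∧ ρ.trace = 1

/-- The trace norm `‖X‖₁ = Tr √(X† X)`, i.e. the sum of the singular values of `X`. -/
def traceNorm (X : Matrix n n ℂ) : ℝ :=
  ∑ i, √((Matrix.isHermitian_conjTranspose_mul_self X).eigenvalues i)

/-- The Gibbs state `e^{-βH} / Tr e^{-βH}`. -/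
def gibbsState (β : ℝ) (H : Matrix n n ℂ) : Matrix n n ℂ :=
  (NormedSpace.exp (-(β : ℂ) • H)).trace⁻¹ • NormedSpace.exp (-(β : ℂ) • H)

/-- Heisenberg evolution `A(t) = e^{iHt} A e^{-iHt}`. -/
def heisenberg (H A : Matrix n n ℂ) (t : ℝ) : Matrix n n ℂ :=
  NormedSpace.exp ((Complex.I * t) • H) * A * NormedSpace.exp ((-Complex.I * t) • H)

/-- The uniform window `1(|t| ≤ T/2) / √T`. -/
def windowFilter (T t : ℝ) : ℝ :=
  if |t| ≤ T / 2 then 1 / √T else 0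

/-- Operator Fourier transform of `A` with filter `f`:
`Â(ω) = (2π)^{-1/2} ∫ e^{-iωt} f(t) A(t) dt`. -/
def operatorFourier (f : ℝ → ℝ) (H A : Matrix n n ℂ) (ω : ℝ) : Matrix n n ℂ :=
  ((1 / √(2 * Real.pi) : ℝ) : ℂ) •
    ∫ t : ℝ, (Complex.exp (-Complex.I * ω * t) * (f t : ℂ)) • heisenberg H A t

/-- The elementary dissipator `ρ ↦ K ρ K† - ½ (K† K ρ + ρ K† K)`, as a superoperator. -/
def dissipator (K : Matrix n n ℂ) : Matrix n n ℂ →L[ℂ] Matrix n n ℂ :=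
  LinearMap.toContinuousLinearMap
    { toFun := fun ρ =>
        K * ρ * K.conjTranspose -
          (1 / 2 : ℂ) • (K.conjTranspose * K * ρ + ρ * (K.conjTranspose * K))
      map_add' := fun X Y => by
        simp only [mul_add, add_mul, smul_add]
        abel
      map_smul' := fun c X => by
        simp only [mul_smul_comm, smul_mul_assoc, smul_sub, smul_add, RingHom.id_apply,
          smul_comm c (1 / 2 : ℂ)] }

/-- The (purely dissipative) Lindbladian
`ρ ↦ ∑ₐ ∫ γ(ω) (Âᵃ(ω) ρ Âᵃ(ω)† - ½ {Âᵃ(ω)† Âᵃ(ω), ρ}) dω`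
in the Schrödinger picture. -/
def lindbladian (f γ : ℝ → ℝ) (H : Matrix n n ℂ) (A : ι → Matrix n n ℂ) :
    Matrix n n ℂ →L[ℂ] Matrix n n ℂ :=
  ∑ a, ∫ ω : ℝ, (γ ω : ℂ) • dissipator (operatorFourier f H (A a) ω)

/-- `t` is the mixing time of the superoperator `L`: the shortest time `t ≥ 0` for which
`‖e^{Lt}[ρ - ρ']‖₁ ≤ ½ ‖ρ - ρ'‖₁` for all pairs of states. -/
def IsMixingTime (L : Matrix n n ℂ →L[ℂ] Matrix n n ℂ) (t : ℝ) : Prop :=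
  IsLeast {s : ℝ | 0 ≤ s ∧ ∀ ρ ρ' : Matrix n n ℂ, IsState ρ → IsState ρ' →
    traceNorm (NormedSpace.exp ((s : ℂ) • L) (ρ - ρ')) ≤ 1 / 2 * traceNorm (ρ - ρ')} t

/-- `ρ` is a fixed point of the dynamics generated by `L`: a state with
`e^{Lt}[ρ] = ρ` for all `t ≥ 0`. -/
def IsFixedState (L : Matrix n n ℂ →L[ℂ] Matrix n n ℂ) (ρ : Matrix n n ℂ) : Prop :=
  IsState ρ ∧ ∀ t : ℝ, 0 ≤ t → NormedSpace.exp ((t : ℂ) • L) ρ = ρ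

end OpenSystem

end

/-! The estimate combines a perturbation bound for fixed points with near-stationarity of the Gibbs
state.

Perturbation (`IsLindbladType.exists_unique_isFixedState`): the semigroup contracts the trace norm
on Hermitian matrices, and at the mixing time it halves traceless ones. Moving `ρ₀` along the flow
for time `t` costs at most `t ‖L ρ₀‖₁`, so the distance `x` from the fixed state to `ρ₀` obeys `x ≤
x / 2 + t ‖L ρ₀‖₁`. Mixing excludes traceless Hermitian kernel elements, which gives uniqueness;
existence comes from a kernel element, which exists because the range of `L` is traceless.

Near-stationarity (`traceNorm_lindbladian_gibbsState_le`): let `R = √ρ_β` and `K = Â(ω)`. Closure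
under adjoints and `ω ↦ -ω` turn the gain term into `γ(-ω) K† R² K`, so gain minus loss vanishes
when the defect `D = √γ(-ω) R K - √γ(ω) K R` does. By `norm_trace_symmetrized_le` it is in fact
linear in `D`, with coefficients whose squared Hilbert–Schmidt norms have total mass at most one by
Plancherel. Hence weighted Cauchy–Schwarz leaves only the size of `D`.

In an energy basis, the entry of `K` at Bohr frequency `ν` decays as `1 / (T (ω - ν)²)` in square,
being a sinc. By KMS the two amplitudes in `D` differ by a factor `exp(±β (ω - ν) / 2)`, so the
relative defect squared is of order `min(1, β² (ω - ν)²)`. The product is a Lorentzian of height `β²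
/ T` and width `1 / β`, with integral of order `β / T`. Optimising the Cauchy–Schwarz weight gives
the square root. -/

namespace OpenSystem

/-! ### Hilbert–Schmidt norm, and the trace norm by duality with contractions -/

open Matrix

variable {n : Type*} [Fintype n]

/-- The squared Hilbert–Schmidt norm. -/
noncomputable def hsSq (X : Matrix n n ℂ) : ℝ := ∑ i, ∑ j, ‖X i j‖ ^ 2

lemma hsSq_nonneg (X : Matrix n n ℂ) : 0 ≤ hsSq X := by unfold hsSq; positivity

lemma hsSq_eq_trace (X : Matrix n n ℂ) : ((hsSq X : ℝ) : ℂ) = (Xᴴ * X).trace := by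
  simp only [hsSq, Matrix.trace, Matrix.diag, Matrix.mul_apply, Matrix.conjTranspose_apply]
  rw [Finset.sum_comm]
  push_cast
  refine Finset.sum_congr rfl fun i _ => Finset.sum_congr rfl fun j _ => ?_
  rw [← Complex.conj_mul']; rfl

lemma hsSq_conjTranspose (X : Matrix n n ℂ) : hsSq Xᴴ = hsSq X := by
  simp only [hsSq, Matrix.conjTranspose_apply, norm_star]
  exact Finset.sum_comm

lemma hsSq_smul (c : ℂ) (X : Matrix n n ℂ) : hsSq (c • X) = ‖c‖ ^ 2 * hsSq X := by
  simp only [hsSq, Matrix.smul_apply, norm_smul, mul_pow, Finset.mul_sum]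

/-- Weighted Cauchy–Schwarz inequality for the Hilbert–Schmidt inner product. -/
lemma norm_trace_conjTranspose_mul_le {δ : ℝ} (hδ : 0 < δ) (X Y : Matrix n n ℂ) :
    ‖(Xᴴ * Y).trace‖ ≤ δ / 2 * hsSq X + 1 / (2 * δ) * hsSq Y := by
  have key : ∀ x y : ℂ, ‖star x * y‖ ≤ δ / 2 * ‖x‖ ^ 2 + 1 / (2 * δ) * ‖y‖ ^ 2 := by
    intro x y
    rw [norm_mul, norm_star]
    have h : 0 ≤ (δ * ‖x‖ - ‖y‖) ^ 2 / (2 * δ) := by positivity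
    have : (δ * ‖x‖ - ‖y‖) ^ 2 / (2 * δ)
        = δ / 2 * ‖x‖ ^ 2 + 1 / (2 * δ) * ‖y‖ ^ 2 - ‖x‖ * ‖y‖ := by
      field_simp; ring
    linarith
  have e : (Xᴴ * Y).trace = ∑ i, ∑ j, star (X i j) * Y i j := by
    simp only [Matrix.trace, Matrix.diag, Matrix.mul_apply, Matrix.conjTranspose_apply]
    exact Finset.sum_comm
  rw [e, hsSq, hsSq, Finset.mul_sum, Finset.mul_sum, ← Finset.sum_add_distrib]
  refine (norm_sum_le _ _).trans (Finset.sum_le_sum fun i _ => ?_)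
  rw [Finset.mul_sum, Finset.mul_sum, ← Finset.sum_add_distrib]
  exact (norm_sum_le _ _).trans (Finset.sum_le_sum fun j _ => key _ _)

variable [DecidableEq n]

lemma norm_mulVec_sq_le (Z : Matrix n n ℂ) (v : n → ℂ) :
    ∑ i, ‖(Z *ᵥ v) i‖ ^ 2 ≤ ‖Z‖ ^ 2 * ∑ i, ‖v i‖ ^ 2 := by
  have h := Matrix.l2_opNorm_mulVec Z (WithLp.toLp 2 v)
  have h2 := pow_le_pow_left₀ (norm_nonneg _) h 2
  rw [mul_pow, EuclideanSpace.norm_sq_eq, EuclideanSpace.norm_sq_eq] at h2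
  exact h2

lemma hsSq_mul_le (Z X : Matrix n n ℂ) : hsSq (Z * X) ≤ ‖Z‖ ^ 2 * hsSq X := by
  have e : ∀ Y : Matrix n n ℂ, hsSq Y = ∑ j, ∑ i, ‖Y i j‖ ^ 2 := fun Y => Finset.sum_comm
  rw [e, e, Finset.mul_sum]
  exact Finset.sum_le_sum fun j _ => norm_mulVec_sq_le Z (fun i => X i j)

lemma hsSq_mul_le' (X Z : Matrix n n ℂ) : hsSq (X * Z) ≤ ‖Z‖ ^ 2 * hsSq X := by
  rw [← hsSq_conjTranspose, conjTranspose_mul, ← hsSq_conjTranspose X,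
    ← Matrix.l2_opNorm_conjTranspose Z]
  exact hsSq_mul_le _ _

lemma hsSq_unitary_mul {U : Matrix n n ℂ} (hU : Uᴴ * U = 1) (X : Matrix n n ℂ) :
    hsSq (U * X) = hsSq X := by
  have : ((hsSq (U * X) : ℝ) : ℂ) = ((hsSq X : ℝ) : ℂ) := by
    rw [hsSq_eq_trace, hsSq_eq_trace, conjTranspose_mul, Matrix.mul_assoc, ← Matrix.mul_assoc Uᴴ,
      hU, Matrix.one_mul]
  exact_mod_cast this

lemma hsSq_mul_unitary {U : Matrix n n ℂ} (hU : U * Uᴴ = 1) (X : Matrix n n ℂ) :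
    hsSq (X * U) = hsSq X := by
  rw [← hsSq_conjTranspose, conjTranspose_mul, hsSq_unitary_mul (by simpa using hU),
    hsSq_conjTranspose]

lemma norm_apply_le (M : Matrix n n ℂ) (i j : n) : ‖M i j‖ ≤ ‖M‖ := by
  have h := norm_mulVec_sq_le M (Pi.single j 1)
  have h1 : ∑ i, ‖(Pi.single j (1 : ℂ) : n → ℂ) i‖ ^ 2 = 1 := by
    rw [Finset.sum_eq_single j] <;> simp +contextual
  rw [h1, mul_one] at h
  have h2 : ‖(M *ᵥ Pi.single j 1) i‖ ^ 2 ≤ ‖M‖ ^ 2 :=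
    (Finset.single_le_sum (f := fun i => ‖(M *ᵥ Pi.single j 1) i‖ ^ 2)
      (fun _ _ => by positivity) (Finset.mem_univ i)).trans h
  simpa using (sq_le_sq₀ (norm_nonneg _) (norm_nonneg _)).1 h2

/-- Diagonalisation of a Hermitian matrix by a unitary. -/
lemma exists_unitary_diagonal {X : Matrix n n ℂ} (hX : X.IsHermitian) :
    ∃ V : Matrix n n ℂ, Vᴴ * V = 1 ∧ V * Vᴴ = 1 ∧
      X = V * diagonal (fun i => (hX.eigenvalues i : ℂ)) * Vᴴ := by
  refine ⟨hX.eigenvectorUnitary, ?_, ?_, ?_⟩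
  · exact Unitary.coe_star_mul_self hX.eigenvectorUnitary
  · exact Unitary.coe_mul_star_self hX.eigenvectorUnitary
  · conv_lhs => rw [hX.spectral_theorem, Unitary.conjStarAlgAut_apply]
    rfl

lemma norm_le_one_of_unitary {V : Matrix n n ℂ} (hV : Vᴴ * V = 1) : ‖V‖ ≤ 1 := by
  rcases isEmpty_or_nonempty n with h | h
  · have : V = 0 := by ext i; exact h.elim i
    simp [this]
  have h1 := Matrix.l2_opNorm_conjTranspose_mul_self V
  rw [hV, norm_one] at h1
  nlinarith [norm_nonneg V]

lemma norm_conj_le {V : Matrix n n ℂ} (hV : Vᴴ * V = 1) (Z : Matrix n n ℂ) :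
    ‖V * Z * Vᴴ‖ ≤ ‖Z‖ := by
  have h1 := norm_le_one_of_unitary hV
  have h2 : ‖Vᴴ‖ ≤ 1 := by rwa [Matrix.l2_opNorm_conjTranspose]
  calc ‖V * Z * Vᴴ‖ ≤ ‖V‖ * ‖Z‖ * ‖Vᴴ‖ :=
        (norm_mul_le _ _).trans (mul_le_mul_of_nonneg_right (norm_mul_le _ _) (norm_nonneg _))
    _ ≤ 1 * ‖Z‖ * 1 := by gcongr
    _ = ‖Z‖ := by ring

lemma trace_conj_unitary {V : Matrix n n ℂ} (hV : Vᴴ * V = 1) (Z : Matrix n n ℂ) :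
    (V * Z * Vᴴ).trace = Z.trace := by
  rw [Matrix.trace_mul_comm, ← Matrix.mul_assoc, hV, Matrix.one_mul]

/-- In an eigenbasis `V` of `X† X`, the trace becomes that of `(V† Z)(X V)`. Column `i` of `X V` has
length the `i`-th singular value, row `i` of `V† Z` has length at most one, and Cauchy–Schwarz
applies to each diagonal entry. -/
lemma norm_trace_mul_le_traceNorm {Z : Matrix n n ℂ} (hZ : ‖Z‖ ≤ 1) (X : Matrix n n ℂ) :
    ‖(Z * X).trace‖ ≤ traceNorm X := by
  set hX := isHermitian_conjTranspose_mul_self X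
  obtain ⟨V, hV, hV', hd⟩ := exists_unitary_diagonal hX
  set μ := hX.eigenvalues
  set W := Vᴴ * Z
  set Y := X * V
  have hY : Yᴴ * Y = diagonal (fun i => (μ i : ℂ)) := by
    have : Yᴴ * Y = Vᴴ * (Xᴴ * X) * V := by
      simp only [Y, conjTranspose_mul, Matrix.mul_assoc]
    rw [this, hd]
    simp only [Matrix.mul_assoc]
    rw [hV, Matrix.mul_one, ← Matrix.mul_assoc, hV, Matrix.one_mul]
  have hW : ‖W * Wᴴ‖ ≤ 1 := by
    have h1 : ‖W‖ ≤ 1 := by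
      refine (norm_mul_le _ _).trans ?_
      rw [Matrix.l2_opNorm_conjTranspose]
      exact mul_le_one₀ (norm_le_one_of_unitary hV) (norm_nonneg _) hZ
    refine (norm_mul_le _ _).trans ?_
    rw [Matrix.l2_opNorm_conjTranspose]
    exact mul_le_one₀ h1 (norm_nonneg _) h1
  have e : (Z * X).trace = (W * Y).trace := by
    rw [show W * Y = Vᴴ * (Z * X) * V by simp only [W, Y, Matrix.mul_assoc],
      Matrix.trace_mul_comm (Vᴴ * (Z * X)) V, ← Matrix.mul_assoc V, hV', Matrix.one_mul]
  have hcol : ∀ i, ∑ k, ‖Y k i‖ ^ 2 = μ i := by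
    intro i
    have h := congrFun (congrFun hY i) i
    rw [Matrix.mul_apply, diagonal_apply_eq] at h
    have : ((∑ k, ‖Y k i‖ ^ 2 : ℝ) : ℂ) = (μ i : ℂ) := by
      rw [← h]; push_cast
      exact Finset.sum_congr rfl fun k _ => by rw [← Complex.conj_mul']; rfl
    exact_mod_cast this
  have hrow : ∀ i, ∑ k, ‖W i k‖ ^ 2 ≤ 1 := by
    intro i
    have h := (norm_apply_le (W * Wᴴ) i i).trans hW
    have h2 : (W * Wᴴ) i i = ((∑ k, ‖W i k‖ ^ 2 : ℝ) : ℂ) := by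
      rw [Matrix.mul_apply]; push_cast
      exact Finset.sum_congr rfl fun k _ => by rw [← Complex.mul_conj']; rfl
    rw [h2, Complex.norm_real] at h
    exact (le_abs_self _).trans h
  rw [e, Matrix.trace, traceNorm]
  refine (norm_sum_le _ _).trans (Finset.sum_le_sum fun i _ => ?_)
  rw [diag_apply, Matrix.mul_apply]
  refine (norm_sum_le _ _).trans ?_
  simp only [norm_mul]
  refine Real.le_sqrt_of_sq_le ?_
  refine (Finset.sum_mul_sq_le_sq_mul_sq _ _ _).trans ?_
  rw [hcol i]
  have hμ : 0 ≤ μ i := by rw [← hcol i]; positivity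
  exact mul_le_of_le_one_left hμ (hrow i)

lemma norm_diagonal_le {v : n → ℂ} {c : ℝ} (hc : 0 ≤ c) (h : ∀ i, ‖v i‖ ≤ c) :
    ‖(diagonal v : Matrix n n ℂ)‖ ≤ c := by
  rw [Matrix.l2_opNorm_diagonal]
  exact (pi_norm_le_iff_of_nonneg hc).2 h

/-- Polar decomposition: the maximiser is `|X|⁻¹ X†`, with the inverse taken on the support of
`|X|`. The convention `0⁻¹ = 0` makes the same formula valid on the kernel. -/
lemma exists_trace_mul_eq_traceNorm (X : Matrix n n ℂ) :
    ∃ Z : Matrix n n ℂ, ‖Z‖ ≤ 1 ∧ (Z * X).trace = (traceNorm X : ℂ) := by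
  set hX := isHermitian_conjTranspose_mul_self X
  obtain ⟨V, hV, hV', hd⟩ := exists_unitary_diagonal hX
  set μ := hX.eigenvalues
  have hμ : ∀ i, 0 ≤ μ i := (Matrix.posSemidef_conjTranspose_mul_self X).eigenvalues_nonneg
  set S : Matrix n n ℂ := diagonal (fun i => (((√(μ i))⁻¹ : ℝ) : ℂ)) with hS
  set D : Matrix n n ℂ := diagonal (fun i => (μ i : ℂ)) with hD
  have mid : ∀ P Q : Matrix n n ℂ, V * P * Vᴴ * (V * Q * Vᴴ) = V * (P * Q) * Vᴴ := by
    intro P Q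
    calc V * P * Vᴴ * (V * Q * Vᴴ) = V * P * (Vᴴ * V) * Q * Vᴴ := by
          simp only [Matrix.mul_assoc]
      _ = _ := by rw [hV, Matrix.mul_one]; simp only [Matrix.mul_assoc]
  have hSS : (V * S * Vᴴ)ᴴ = V * S * Vᴴ := by
    simp only [conjTranspose_mul, conjTranspose_conjTranspose, Matrix.mul_assoc, hS,
      diagonal_conjTranspose]
    congr 3
    ext i
    simp
  refine ⟨V * S * Vᴴ * Xᴴ, ?_, ?_⟩
  · have h1 := Matrix.l2_opNorm_conjTranspose_mul_self ((V * S * Vᴴ * Xᴴ)ᴴ)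
    rw [conjTranspose_conjTranspose, Matrix.l2_opNorm_conjTranspose] at h1
    have h2 : V * S * Vᴴ * Xᴴ * (V * S * Vᴴ * Xᴴ)ᴴ = V * (S * D * S) * Vᴴ := by
      rw [conjTranspose_mul, hSS, conjTranspose_conjTranspose]
      calc V * S * Vᴴ * Xᴴ * (X * (V * S * Vᴴ)) = V * S * Vᴴ * (Xᴴ * X) * (V * S * Vᴴ) := by
            simp only [Matrix.mul_assoc]
        _ = _ := by rw [hd, mid, mid]
    have h3 : ‖V * (S * D * S) * Vᴴ‖ ≤ 1 := by
      refine (norm_conj_le hV _).trans ?_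
      rw [hS, hD, diagonal_mul_diagonal, diagonal_mul_diagonal]
      refine norm_diagonal_le zero_le_one fun i => ?_
      rw [← Complex.ofReal_mul, ← Complex.ofReal_mul, Complex.norm_real]
      rcases (hμ i).eq_or_lt with h | h
      · simp [← h]
      · have : (√(μ i))⁻¹ * μ i * (√(μ i))⁻¹ = 1 := by
          have hs := Real.sqrt_pos.2 h
          field_simp
          rw [Real.sq_sqrt h.le]
        rw [this]; simp
    rw [← h2, h1] at h3
    nlinarith [norm_nonneg (V * S * Vᴴ * Xᴴ)]
  · rw [Matrix.mul_assoc, hd, mid, trace_conj_unitary hV, hS, hD, diagonal_mul_diagonal,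
      trace_diagonal, traceNorm]
    push_cast
    refine Finset.sum_congr rfl fun i _ => ?_
    rw [← Complex.ofReal_inv, ← Complex.ofReal_mul]
    congr 1
    change (√(μ i))⁻¹ * μ i = √(μ i)
    rcases (hμ i).eq_or_lt with h | h
    · simp [← h]
    · have hs := Real.sqrt_pos.2 h
      field_simp
      rw [Real.sq_sqrt h.le]

/-- This variational form is how upper bounds on the trace norm are proved here, from the triangle
inequality to the estimate on the generator. -/
lemma traceNorm_le_of_forall {X : Matrix n n ℂ} {c : ℝ}
    (h : ∀ Z : Matrix n n ℂ, ‖Z‖ ≤ 1 → ‖(Z * X).trace‖ ≤ c) : traceNorm X ≤ c := by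
  obtain ⟨Z, hZ, e⟩ := exists_trace_mul_eq_traceNorm X
  have := h Z hZ
  rw [e, Complex.norm_real] at this
  exact (le_abs_self _).trans this

lemma traceNorm_nonneg (X : Matrix n n ℂ) : 0 ≤ traceNorm X := by unfold traceNorm; positivity

lemma traceNorm_add_le (X Y : Matrix n n ℂ) : traceNorm (X + Y) ≤ traceNorm X + traceNorm Y := by
  refine traceNorm_le_of_forall fun Z hZ => ?_
  rw [Matrix.mul_add, Matrix.trace_add]
  exact (norm_add_le _ _).trans
    (add_le_add (norm_trace_mul_le_traceNorm hZ X) (norm_trace_mul_le_traceNorm hZ Y))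

lemma traceNorm_smul_le (c : ℂ) (X : Matrix n n ℂ) : traceNorm (c • X) ≤ ‖c‖ * traceNorm X := by
  refine traceNorm_le_of_forall fun Z hZ => ?_
  rw [Matrix.mul_smul, Matrix.trace_smul, norm_smul]
  exact mul_le_mul_of_nonneg_left (norm_trace_mul_le_traceNorm hZ X) (norm_nonneg _)

lemma traceNorm_smul (c : ℂ) (X : Matrix n n ℂ) : traceNorm (c • X) = ‖c‖ * traceNorm X := by
  refine le_antisymm (traceNorm_smul_le c X) ?_
  rcases eq_or_ne c 0 with rfl | hc
  · simpa using traceNorm_nonneg _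
  · have h := traceNorm_smul_le c⁻¹ (c • X)
    rw [smul_smul, inv_mul_cancel₀ hc, one_smul, norm_inv] at h
    have := norm_pos_iff.2 hc
    rwa [inv_mul_eq_div, le_div_iff₀ this, mul_comm] at h

lemma traceNorm_neg (X : Matrix n n ℂ) : traceNorm (-X) = traceNorm X := by
  have := traceNorm_smul (-1) X
  simpa using this

lemma traceNorm_sub_le (X Y : Matrix n n ℂ) : traceNorm (X - Y) ≤ traceNorm X + traceNorm Y := by
  rw [sub_eq_add_neg, ← traceNorm_neg Y]; exact traceNorm_add_le _ _

lemma eq_zero_of_traceNorm_le_zero {X : Matrix n n ℂ} (h : traceNorm X ≤ 0) : X = 0 := by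
  by_contra hX
  have hZ : ‖((‖X‖⁻¹ : ℝ) : ℂ) • Xᴴ‖ ≤ 1 := by
    rw [norm_smul, Matrix.l2_opNorm_conjTranspose, Complex.norm_real, Real.norm_of_nonneg
      (by positivity), inv_mul_cancel₀ (norm_ne_zero_iff.2 hX)]
  have h1 := (norm_trace_mul_le_traceNorm hZ X).trans h
  rw [Matrix.smul_mul, Matrix.trace_smul, norm_le_zero_iff, smul_eq_zero] at h1
  rcases h1 with h1 | h1
  · simp [hX] at h1
  · exact hX (Matrix.trace_conjTranspose_mul_self_eq_zero_iff.1 h1)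

lemma traceNorm_zero : traceNorm (0 : Matrix n n ℂ) = 0 := by
  have := traceNorm_smul 0 (0 : Matrix n n ℂ)
  simpa using this

/-- Comparison of the trace norm with the operator norm. -/
lemma traceNorm_le_card_mul (X : Matrix n n ℂ) : traceNorm X ≤ Fintype.card n * ‖X‖ := by
  refine traceNorm_le_of_forall fun Z hZ => ?_
  rw [Matrix.trace, ← nsmul_eq_mul, Fintype.card, ← Finset.sum_const]
  refine (norm_sum_le _ _).trans (Finset.sum_le_sum fun i _ => ?_)
  refine (norm_apply_le _ _ _).trans ((norm_mul_le _ _).trans ?_)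
  exact mul_le_of_le_one_left (norm_nonneg _) hZ

lemma exists_eq_conjTranspose_mul_self {P : Matrix n n ℂ} (hP : P.PosSemidef) :
    ∃ B : Matrix n n ℂ, P = Bᴴ * B := by
  obtain ⟨V, hV, hV', hd⟩ := exists_unitary_diagonal hP.1
  refine ⟨diagonal (fun i => ((√(hP.1.eigenvalues i) : ℝ) : ℂ)) * Vᴴ, ?_⟩
  conv_lhs => rw [hd]
  rw [conjTranspose_mul, diagonal_conjTranspose, conjTranspose_conjTranspose,
    Matrix.mul_assoc V (diagonal _) (diagonal _ * Vᴴ), ← Matrix.mul_assoc (diagonal _),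
    diagonal_mul_diagonal, ← Matrix.mul_assoc]
  congr 3
  ext i
  simp only [Pi.star_apply, RCLike.star_def, Complex.conj_ofReal]
  rw [← Complex.ofReal_mul, Real.mul_self_sqrt (hP.eigenvalues_nonneg i)]

/-- With `P = B† B`, the pairing with a contraction `Z` is the inner product of `B` and `B Z`, both
of Hilbert–Schmidt norm at most `√(Tr P)`. -/
lemma traceNorm_posSemidef {P : Matrix n n ℂ} (hP : P.PosSemidef) :
    traceNorm P ≤ P.trace.re := by
  refine traceNorm_le_of_forall fun Z hZ => ?_
  obtain ⟨B, rfl⟩ := exists_eq_conjTranspose_mul_self hP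
  have e : (Z * (Bᴴ * B)).trace = (Bᴴ * (B * Z)).trace := by
    rw [← Matrix.mul_assoc, Matrix.trace_mul_comm, ← Matrix.mul_assoc, Matrix.trace_mul_comm]
  rw [e, ← hsSq_eq_trace, Complex.ofReal_re]
  have h1 := norm_trace_conjTranspose_mul_le one_pos B (B * Z)
  have h2 := hsSq_mul_le' B Z
  have h3 : ‖Z‖ ^ 2 * hsSq B ≤ hsSq B :=
    mul_le_of_le_one_left (hsSq_nonneg _) (pow_le_one₀ (norm_nonneg _) hZ)
  linarith

/-- Jordan decomposition of a Hermitian matrix. -/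
lemma exists_posSemidef_sub {X : Matrix n n ℂ} (hX : X.IsHermitian) :
    ∃ P N : Matrix n n ℂ, P.PosSemidef ∧ N.PosSemidef ∧ X = P - N ∧
      P.trace.re + N.trace.re ≤ traceNorm X := by
  obtain ⟨V, hV, hV', hd⟩ := exists_unitary_diagonal hX
  set μ := hX.eigenvalues
  have psd : ∀ w : n → ℝ, (∀ i, 0 ≤ w i) →
      (V * diagonal (fun i => (w i : ℂ)) * Vᴴ).PosSemidef := by
    intro w hw
    refine PosSemidef.mul_mul_conjTranspose_same ?_ V
    exact PosSemidef.diagonal fun i => by simpa using hw i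
  refine ⟨V * diagonal (fun i => ((max (μ i) 0 : ℝ) : ℂ)) * Vᴴ,
    V * diagonal (fun i => ((max (-μ i) 0 : ℝ) : ℂ)) * Vᴴ,
    psd _ fun i => le_max_right _ _, psd _ fun i => le_max_right _ _, ?_, ?_⟩
  · conv_lhs => rw [hd]
    rw [← Matrix.sub_mul, ← Matrix.mul_sub, diagonal_sub]
    congr 3
    ext i
    rw [← Complex.ofReal_sub]
    congr 1
    rcases le_total 0 (μ i) with h | h <;> simp [h]
  -- The sign of `X` is a contraction whose pairing with `X` is the sum of `|μ i|`.
  · set s : Matrix n n ℂ := diagonal (fun i => ((if 0 ≤ μ i then 1 else -1 : ℝ) : ℂ))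
    have hs : ‖V * s * Vᴴ‖ ≤ 1 := by
      refine (norm_conj_le hV _).trans (norm_diagonal_le zero_le_one fun i => ?_)
      split_ifs <;> simp
    refine le_trans (le_of_eq ?_) (norm_trace_mul_le_traceNorm hs X)
    have : (V * s * Vᴴ * X).trace = ((∑ i, |μ i| : ℝ) : ℂ) := by
      conv_lhs => rw [hd]
      have : V * s * Vᴴ * (V * diagonal (fun i => (μ i : ℂ)) * Vᴴ)
          = V * (s * diagonal (fun i => (μ i : ℂ))) * Vᴴ := by
        calc _ = V * s * (Vᴴ * V) * diagonal (fun i => (μ i : ℂ)) * Vᴴ := by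
              simp only [Matrix.mul_assoc]
          _ = _ := by rw [hV, Matrix.mul_one]; simp only [Matrix.mul_assoc]
      rw [this, trace_conj_unitary hV, diagonal_mul_diagonal, trace_diagonal]
      push_cast
      refine Finset.sum_congr rfl fun i _ => ?_
      split_ifs with h
      · rw [abs_of_nonneg h]; simp
      · rw [abs_of_neg (not_le.1 h)]; simp
    rw [this, Complex.norm_real, Real.norm_of_nonneg (by positivity), trace_conj_unitary hV,
      trace_conj_unitary hV, trace_diagonal, trace_diagonal, ← Complex.ofReal_sum,
      ← Complex.ofReal_sum, Complex.ofReal_re, Complex.ofReal_re, ← Finset.sum_add_distrib]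
    refine Finset.sum_congr rfl fun i _ => ?_
    rcases le_total 0 (μ i) with h | h <;> simp [h, abs_of_nonneg, abs_of_nonpos]

/-- A Hermitian matrix of unit trace and trace norm at most one is a state. -/
lemma isState_of_traceNorm_le_one {X : Matrix n n ℂ} (hX : X.IsHermitian) (ht : X.trace = 1)
    (h : traceNorm X ≤ 1) : IsState X := by
  obtain ⟨P, N, hP, hN, rfl, hPN⟩ := exists_posSemidef_sub hX
  -- The two traces differ by one and sum to at most one, so the negative part has trace zero.
  have h1 : P.trace.re - N.trace.re = 1 := by
    rw [← Complex.sub_re, ← Matrix.trace_sub, ht, Complex.one_re]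
  have h2 := Complex.le_def.1 hN.trace_nonneg
  have h3 : N.trace = 0 := by
    refine Complex.ext ?_ h2.2.symm
    have := h2.1
    simp only [Complex.zero_re] at this ⊢
    linarith
  have h4 := hN.trace_eq_zero_iff.1 h3
  subst h4
  exact ⟨by simpa using hP, ht⟩

lemma IsState.traceNorm_le_one {ρ : Matrix n n ℂ} (h : IsState ρ) : traceNorm ρ ≤ 1 := by
  have := traceNorm_posSemidef h.1
  rwa [h.2, Complex.one_re] at this

end OpenSystem

/-! ### Lindblad-type generators: contractivity, fixed states and their stability -/

namespace OpenSystem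

open Matrix

open Filter Topology

variable {n : Type*} [Fintype n] [DecidableEq n]

/-- `L` is of the form `X ↦ Φ X - ½ {G, X}` with `Φ` positive and `Tr ∘ Φ = Tr (G ·)`. -/
def IsLindbladType (L : Matrix n n ℂ →L[ℂ] Matrix n n ℂ) : Prop :=
  ∃ (Φ : Matrix n n ℂ → Matrix n n ℂ) (G : Matrix n n ℂ), G.IsHermitian ∧
    (∀ P, P.PosSemidef → (Φ P).PosSemidef) ∧ (∀ X, (Φ X).trace = (G * X).trace) ∧
    ∀ X, L X = Φ X - (1 / 2 : ℂ) • (G * X + X * G)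

section LindbladType

variable {L : Matrix n n ℂ →L[ℂ] Matrix n n ℂ}

omit [DecidableEq n] in
lemma IsLindbladType.trace_apply (hL : IsLindbladType L) (X : Matrix n n ℂ) :
    (L X).trace = 0 := by
  obtain ⟨Φ, G, -, -, ht, hΦ⟩ := hL
  rw [hΦ, trace_sub, trace_smul, trace_add, trace_mul_comm X G, ht, smul_eq_mul]
  ring

omit [DecidableEq n] in
lemma isHermitian_half_anticommutator {G X : Matrix n n ℂ} (hG : G.IsHermitian)
    (hX : X.IsHermitian) : ((1 / 2 : ℂ) • (G * X + X * G)).IsHermitian := by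
  unfold Matrix.IsHermitian
  rw [conjTranspose_smul, conjTranspose_add, conjTranspose_mul, conjTranspose_mul, hG.eq, hX.eq,
    add_comm]
  simp

lemma IsLindbladType.isHermitian_apply (hL : IsLindbladType L) {X : Matrix n n ℂ}
    (hX : X.IsHermitian) : (L X).IsHermitian := by
  obtain ⟨Φ, G, hG, hp, ht, hΦ⟩ := hL
  have psd : ∀ P : Matrix n n ℂ, P.PosSemidef → (L P).IsHermitian := fun P hP => by
    rw [hΦ]; exact (hp P hP).1.sub (isHermitian_half_anticommutator hG hP.1)
  obtain ⟨P, N, hP, hN, rfl, -⟩ := exists_posSemidef_sub hX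
  rw [map_sub]
  exact (psd P hP).sub (psd N hN)

/-- To first order an Euler step is a positive trace-preserving map: completing the square gives `P
+ ε L P = (ε Φ P + K P K) - (ε² / 4) G P G` with `K = 1 - (ε / 2) G`. The trace of the bracket
exceeds `Tr P` by `(ε² / 4) Tr (G P G)`; with the subtracted term this makes an error of `ε² ‖G‖² /
2`. The Jordan decomposition passes from positive to Hermitian matrices. -/
lemma IsLindbladType.exists_traceNorm_add_smul_le (hL : IsLindbladType L) :
    ∃ c : ℝ, ∀ X : Matrix n n ℂ, X.IsHermitian → ∀ ε : ℝ, 0 ≤ ε →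
      traceNorm (X + (ε : ℂ) • L X) ≤ (1 + c * ε ^ 2) * traceNorm X := by
  obtain ⟨Φ, G, hG, hp, ht, hΦ⟩ := hL
  refine ⟨‖G‖ ^ 2 / 2, ?_⟩
  have psd : ∀ P : Matrix n n ℂ, P.PosSemidef → ∀ ε : ℝ, 0 ≤ ε →
      traceNorm (P + (ε : ℂ) • L P) ≤ (1 + ‖G‖ ^ 2 / 2 * ε ^ 2) * P.trace.re := by
    intro P hP ε hε
    set K : Matrix n n ℂ := 1 - ((ε / 2 : ℝ) : ℂ) • G with hK
    have hKH : Kᴴ = K := by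
      rw [hK, conjTranspose_sub, conjTranspose_one, conjTranspose_smul, hG.eq]
      simp
    have hGPG : (G * P * G).PosSemidef := by
      have := hP.mul_mul_conjTranspose_same G
      rwa [hG.eq] at this
    have hKPK : (K * P * K).PosSemidef := by
      have := hP.mul_mul_conjTranspose_same K
      rwa [hKH] at this
    have h1 : ((ε : ℂ) • Φ P + K * P * K).PosSemidef :=
      ((hp P hP).smul (by simpa using hε)).add hKPK
    have e1 : P + (ε : ℂ) • L P
        = ((ε : ℂ) • Φ P + K * P * K) - ((ε ^ 2 / 4 : ℝ) : ℂ) • (G * P * G) := by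
      rw [hΦ, hK]
      simp only [Matrix.sub_mul, Matrix.mul_sub, Matrix.one_mul, Matrix.mul_one, smul_mul_assoc,
        mul_smul_comm, smul_sub, smul_add, smul_smul]
      push_cast
      module
    have e2 : ((ε : ℂ) • Φ P + K * P * K).trace
        = P.trace + ((ε ^ 2 / 4 : ℝ) : ℂ) * (G * P * G).trace := by
      rw [hK]
      simp only [Matrix.sub_mul, Matrix.mul_sub, Matrix.one_mul, Matrix.mul_one, smul_mul_assoc,
        mul_smul_comm, smul_sub, smul_smul, trace_add, trace_sub, trace_smul, ht, smul_eq_mul,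
        trace_mul_comm P G]
      push_cast
      ring
    have h3 : (G * P * G).trace.re ≤ ‖G‖ ^ 2 * P.trace.re := by
      obtain ⟨B, rfl⟩ := exists_eq_conjTranspose_mul_self hP
      have : G * (Bᴴ * B) * G = (B * G)ᴴ * (B * G) := by
        rw [conjTranspose_mul, hG.eq]; simp only [Matrix.mul_assoc]
      rw [this, ← hsSq_eq_trace, ← hsSq_eq_trace, Complex.ofReal_re, Complex.ofReal_re]
      exact hsSq_mul_le' B G
    rw [e1]
    refine (traceNorm_sub_le _ _).trans ?_
    rw [traceNorm_smul, Complex.norm_real, Real.norm_of_nonneg (by positivity)]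
    have h4 := traceNorm_posSemidef h1
    have h5 := traceNorm_posSemidef hGPG
    rw [e2, Complex.add_re, Complex.re_ofReal_mul] at h4
    nlinarith [mul_le_mul_of_nonneg_left h5 (by positivity : 0 ≤ ε ^ 2 / 4),
      mul_le_mul_of_nonneg_left h3 (by positivity : 0 ≤ ε ^ 2 / 2)]
  intro X hX ε hε
  obtain ⟨P, N, hP, hN, rfl, hPN⟩ := exists_posSemidef_sub hX
  have e : P - N + (ε : ℂ) • L (P - N) = (P + (ε : ℂ) • L P) - (N + (ε : ℂ) • L N) := by
    rw [map_sub, smul_sub]; abel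
  rw [e]
  refine (traceNorm_sub_le _ _).trans ((add_le_add (psd P hP ε hε) (psd N hN ε hε)).trans ?_)
  rw [← mul_add]
  exact mul_le_mul_of_nonneg_left hPN (by positivity)

end LindbladType

section NormedSpace

variable {E : Type*} [NormedAddCommGroup E] [NormedSpace ℂ E] [CompleteSpace E] (L : E →L[ℂ] E)

lemma hasDerivAt_exp_smul_apply_of_normed (X : E) (t : ℝ) :
    HasDerivAt (fun s : ℝ => NormedSpace.exp ((s : ℂ) • L) X)
      (NormedSpace.exp ((t : ℂ) • L) (L X)) t := by
  have h := hasDerivAt_exp_smul_const (𝕂 := ℂ) L (t : ℂ)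
  have h2 := (h.clm_apply (hasDerivAt_const (t : ℂ) X)).scomp t
    Complex.ofRealCLM.hasDerivAt
  simpa [Function.comp_def] using h2

omit [CompleteSpace E] in
lemma exp_smul_apply_comm_of_normed (X : E) (t : ℂ) :
    NormedSpace.exp (t • L) (L X) = L (NormedSpace.exp (t • L) X) := by
  have h : Commute (NormedSpace.exp (t • L)) L :=
    ((Commute.refl L).smul_left t).exp_left
  exact DFunLike.congr_fun h.eq X

omit [CompleteSpace E] in
lemma exp_zero_smul_apply_of_normed (X : E) :
    NormedSpace.exp (((0 : ℝ) : ℂ) • L) X = X := by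
  simp

lemma hasSum_exp_smul_apply_of_normed (X : E) (t : ℂ) :
    HasSum (fun k : ℕ => ((k.factorial : ℂ)⁻¹ * t ^ k) • L^[k] X)
      (NormedSpace.exp (t • L) X) := by
  have h1 := NormedSpace.exp_series_hasSum_exp' (𝕂 := ℂ) (t • L)
  have h2 := h1.mapL (ContinuousLinearMap.apply ℂ E X)
  convert h2 using 2 with k
  · rw [smul_pow]
    simp [mul_smul]
  · rfl

end NormedSpace

/-! ### The semigroup on matrices -/

section Semigroup

variable (L : Matrix n n ℂ →L[ℂ] Matrix n n ℂ)

lemma hasDerivAt_exp_smul_apply (X : Matrix n n ℂ) (t : ℝ) :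
    HasDerivAt (fun s : ℝ => NormedSpace.exp ((s : ℂ) • L) X)
      (NormedSpace.exp ((t : ℂ) • L) (L X)) t :=
  hasDerivAt_exp_smul_apply_of_normed L X t

lemma exp_smul_apply_comm (X : Matrix n n ℂ) (t : ℂ) :
    NormedSpace.exp (t • L) (L X) = L (NormedSpace.exp (t • L) X) :=
  exp_smul_apply_comm_of_normed L X t

lemma exp_zero_smul_apply (X : Matrix n n ℂ) :
    NormedSpace.exp (((0 : ℝ) : ℂ) • L) X = X :=
  exp_zero_smul_apply_of_normed L X

lemma hasSum_exp_smul_apply (X : Matrix n n ℂ) (t : ℂ) :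
    HasSum (fun k : ℕ => ((k.factorial : ℂ)⁻¹ * t ^ k) • L^[k] X)
      (NormedSpace.exp (t • L) X) :=
  hasSum_exp_smul_apply_of_normed L X t

variable {L}

lemma exp_smul_apply_of_apply_eq_zero {X : Matrix n n ℂ} (h : L X = 0) (t : ℝ) :
    NormedSpace.exp ((t : ℂ) • L) X = X := by
  have hd : ∀ s : ℝ, HasDerivAt (fun s : ℝ => NormedSpace.exp ((s : ℂ) • L) X) 0 s := fun s => by
    simpa [h] using hasDerivAt_exp_smul_apply L X s
  have := is_const_of_deriv_eq_zero (fun s => (hd s).differentiableAt) (fun s => (hd s).deriv) t 0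
  rwa [exp_zero_smul_apply] at this

lemma IsLindbladType.trace_exp_apply (hL : IsLindbladType L) (X : Matrix n n ℂ) (t : ℝ) :
    (NormedSpace.exp ((t : ℂ) • L) X).trace = X.trace := by
  let τ : Matrix n n ℂ →L[ℂ] ℂ := LinearMap.toContinuousLinearMap (Matrix.traceLinearMap n ℂ ℂ)
  have hd : ∀ s : ℝ, HasDerivAt (fun s : ℝ => τ (NormedSpace.exp ((s : ℂ) • L) X)) 0 s :=
    fun s => by
      have h := (τ.restrictScalars ℝ).hasFDerivAt.comp_hasDerivAt s
        (hasDerivAt_exp_smul_apply L X s)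
      have h0 : τ (NormedSpace.exp ((s : ℂ) • L) (L X)) = 0 := by
        rw [exp_smul_apply_comm]; exact hL.trace_apply _
      simpa [Function.comp_def, h0] using h
  have := is_const_of_deriv_eq_zero (fun s => (hd s).differentiableAt) (fun s => (hd s).deriv) t 0
  rw [exp_zero_smul_apply] at this
  exact this

lemma IsLindbladType.isHermitian_exp_apply (hL : IsLindbladType L) {X : Matrix n n ℂ}
    (hX : X.IsHermitian) (t : ℝ) : (NormedSpace.exp ((t : ℂ) • L) X).IsHermitian := by
  have h2 := hasSum_exp_smul_apply L X t
  refine h2.matrix_conjTranspose.unique ?_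
  convert h2 using 2 with k
  have hk : (L^[k] X).IsHermitian := by
    induction k with
    | zero => exact hX
    | succ k ih =>
      rw [Function.iterate_succ_apply']
      exact hL.isHermitian_apply ih
  rw [conjTranspose_smul, hk.eq]
  simp

lemma continuous_traceNorm : Continuous (traceNorm : Matrix n n ℂ → ℝ) := by
  refine LipschitzWith.continuous (K := Fintype.card n) ?_
  refine LipschitzWith.of_dist_le_mul fun X Y => ?_
  rw [Real.dist_eq, dist_eq_norm, abs_sub_le_iff]
  have key : ∀ X Y : Matrix n n ℂ, traceNorm X - traceNorm Y ≤ Fintype.card n * ‖X - Y‖ := by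
    intro X Y
    have h := traceNorm_add_le (X - Y) Y
    rw [sub_add_cancel] at h
    linarith [traceNorm_le_card_mul (X - Y)]
  refine ⟨key X Y, ?_⟩
  rw [norm_sub_rev]
  exact key Y X

/-- Trace-norm contractivity of the semigroup on Hermitian matrices. -/
lemma IsLindbladType.traceNorm_exp_apply_le (hL : IsLindbladType L) {X : Matrix n n ℂ}
    (hX : X.IsHermitian) {t : ℝ} (ht : 0 ≤ t) :
    traceNorm (NormedSpace.exp ((t : ℂ) • L) X) ≤ traceNorm X := by
  obtain ⟨c, hc⟩ := hL.exists_traceNorm_add_smul_le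
  set u : ℝ → Matrix n n ℂ := fun s => NormedSpace.exp ((s : ℂ) • L) X with hu
  have hud : ∀ s, HasDerivAt u (L (u s)) s := fun s => by
    have := hasDerivAt_exp_smul_apply L X s
    rwa [exp_smul_apply_comm] at this
  have huc : Continuous u := continuous_iff_continuousAt.2 fun s => (hud s).continuousAt
  -- The trace norm along the flow need not be differentiable, so monotonicity is derived from right
  -- slopes. A short step is an Euler step, quadratic in norm growth, plus a remainder of size `o(z
  -- - x)`.
  refine image_le_of_liminf_slope_right_le_deriv_boundary (f := fun s => traceNorm (u s))
    (a := 0) (b := t) (B := fun _ => traceNorm X) (B' := fun _ => 0)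
    (continuous_traceNorm.comp huc).continuousOn ?_ continuousOn_const
    (fun x _ => hasDerivWithinAt_const _ _ _) ?_ ⟨ht, le_rfl⟩
  · exact le_of_eq (congrArg traceNorm (exp_zero_smul_apply L X))
  · intro x _ r hr
    have hux : (u x).IsHermitian := hL.isHermitian_exp_apply hX x
    have hs : Tendsto (fun z => c * (z - x) * traceNorm (u x)
        + Fintype.card n * ‖slope u x z - L (u x)‖) (𝓝[>] x) (𝓝 0) := by
      have h1 : Tendsto (slope u x) (𝓝[>] x) (𝓝 (L (u x))) :=
        (hasDerivAt_iff_tendsto_slope.1 (hud x)).mono_left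
          (nhdsWithin_mono x fun z hz => ne_of_gt hz)
      have h2 : Tendsto (fun z => Fintype.card n * ‖slope u x z - L (u x)‖) (𝓝[>] x) (𝓝 0) := by
        have := ((h1.sub_const (L (u x))).norm).const_mul (Fintype.card n : ℝ)
        simpa using this
      have h3 : Tendsto (fun z => c * (z - x) * traceNorm (u x)) (𝓝[>] x) (𝓝 0) := by
        have : Continuous fun z => c * (z - x) * traceNorm (u x) := by fun_prop
        have := this.tendsto x
        simp only [sub_self, mul_zero, zero_mul] at this
        exact this.mono_left nhdsWithin_le_nhds
      simpa using h3.add h2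
    have hev : ∀ᶠ z in 𝓝[>] x, slope (fun s => traceNorm (u s)) x z < r := by
      filter_upwards [hs.eventually (gt_mem_nhds hr), self_mem_nhdsWithin] with z hz hzx
      refine lt_of_le_of_lt ?_ hz
      have hzx' : 0 < z - x := sub_pos.2 hzx
      rw [slope_def_field, div_le_iff₀ hzx']
      have e : u z = (u x + ((z - x : ℝ) : ℂ) • L (u x))
          + ((z - x : ℝ) : ℂ) • (slope u x z - L (u x)) := by
        rw [slope_def_module, smul_sub, Complex.coe_smul, Complex.coe_smul, smul_smul,
          mul_inv_cancel₀ hzx'.ne', one_smul]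
        abel
      have h1 := traceNorm_add_le (u x + ((z - x : ℝ) : ℂ) • L (u x))
        (((z - x : ℝ) : ℂ) • (slope u x z - L (u x)))
      rw [← e, traceNorm_smul, Complex.norm_real, Real.norm_of_nonneg hzx'.le] at h1
      have h2 := hc (u x) hux (z - x) hzx'.le
      have h3 := mul_le_mul_of_nonneg_left (traceNorm_le_card_mul (slope u x z - L (u x))) hzx'.le
      nlinarith
    exact hev.frequently

/-- The velocity along the flow is `e^{sL} (L X)`, whose trace norm is at most that of `L X` by
contractivity. The mean value inequality is applied to the scalar pairing with each contraction. -/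
lemma IsLindbladType.traceNorm_exp_apply_sub_le (hL : IsLindbladType L) {X : Matrix n n ℂ}
    (hX : X.IsHermitian) {t : ℝ} (ht : 0 ≤ t) :
    traceNorm (NormedSpace.exp ((t : ℂ) • L) X - X) ≤ t * traceNorm (L X) := by
  refine traceNorm_le_of_forall fun Z hZ => ?_
  let τ : Matrix n n ℂ →L[ℂ] ℂ := LinearMap.toContinuousLinearMap
    (Matrix.traceLinearMap n ℂ ℂ ∘ₗ LinearMap.mulLeft ℂ Z)
  have hτ : ∀ Y, τ Y = (Z * Y).trace := fun Y => rfl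
  have hd : ∀ s : ℝ, HasDerivAt (fun s : ℝ => τ (NormedSpace.exp ((s : ℂ) • L) X))
      (τ (NormedSpace.exp ((s : ℂ) • L) (L X))) s := fun s =>
    (τ.restrictScalars ℝ).hasFDerivAt.comp_hasDerivAt s (hasDerivAt_exp_smul_apply L X s)
  have := norm_image_sub_le_of_norm_deriv_le_segment' (a := 0) (b := t) (C := traceNorm (L X))
    (fun s _ => (hd s).hasDerivWithinAt)
    (fun s hs => (norm_trace_mul_le_traceNorm hZ _).trans
      (hL.traceNorm_exp_apply_le (hL.isHermitian_apply hX) hs.1)) t ⟨ht, le_rfl⟩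
  rw [exp_zero_smul_apply, ← map_sub, hτ] at this
  linarith

/-- The mixing condition extends to all traceless Hermitian matrices. -/
lemma traceNorm_apply_le_half_of_trace_eq_zero {P : Matrix n n ℂ →L[ℂ] Matrix n n ℂ}
    (hP : ∀ ρ ρ' : Matrix n n ℂ, IsState ρ → IsState ρ' →
      traceNorm (P (ρ - ρ')) ≤ 1 / 2 * traceNorm (ρ - ρ'))
    {X : Matrix n n ℂ} (hX : X.IsHermitian) (ht : X.trace = 0) :
    traceNorm (P X) ≤ 1 / 2 * traceNorm X := by
  obtain ⟨A, B, hA, hB, rfl, -⟩ := exists_posSemidef_sub hX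
  have hAB : A.trace = B.trace := by rwa [trace_sub, sub_eq_zero] at ht
  by_cases h0 : A.trace = 0
  · rw [hA.trace_eq_zero_iff.1 h0, hB.trace_eq_zero_iff.1 (hAB ▸ h0)]
    simp [traceNorm_zero]
  -- The positive and negative parts have the same trace; dividing by it gives two states, and the
  -- inequality is homogeneous.
  · have hst : ∀ Q : Matrix n n ℂ, Q.PosSemidef → Q.trace = A.trace →
        IsState (A.trace⁻¹ • Q) := by
      intro Q hQ hQA
      refine ⟨hQ.smul (inv_nonneg.2 hA.trace_nonneg), ?_⟩
      rw [trace_smul, hQA, smul_eq_mul, inv_mul_cancel₀ h0]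
    have h := hP _ _ (hst A hA rfl) (hst B hB hAB.symm)
    rw [← smul_sub, map_smul, traceNorm_smul, traceNorm_smul] at h
    have hpos : 0 < ‖A.trace⁻¹‖ := norm_pos_iff.2 (inv_ne_zero h0)
    nlinarith

/-- The range is traceless, so it misses the identity; in finite dimension `L` then has a kernel.
Since `L` preserves Hermiticity, the Hermitian parts `A` and `B` of a kernel element satisfy `L B =
-i L A` with both sides Hermitian, so both are annihilated, and one of them is nonzero. -/
lemma IsLindbladType.exists_isHermitian_apply_eq_zero [Nonempty n] (hL : IsLindbladType L) :
    ∃ X : Matrix n n ℂ, X.IsHermitian ∧ X ≠ 0 ∧ L X = 0 := by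
  have hinj : ¬ Function.Injective (L : Matrix n n ℂ →ₗ[ℂ] Matrix n n ℂ) := by
    rw [LinearMap.injective_iff_surjective]
    intro hs
    obtain ⟨X, hX⟩ := hs 1
    have h1 := hL.trace_apply X
    rw [show L X = 1 from hX, trace_one] at h1
    simp at h1
  rw [← LinearMap.ker_eq_bot, Submodule.eq_bot_iff] at hinj
  push Not at hinj
  obtain ⟨X, hX, hX0⟩ := hinj
  have hLX : L X = 0 := hX
  set A : Matrix n n ℂ := X + Xᴴ with hA
  set B : Matrix n n ℂ := Complex.I • (X - Xᴴ) with hB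
  have hAH : A.IsHermitian := by
    unfold Matrix.IsHermitian
    rw [hA, conjTranspose_add, conjTranspose_conjTranspose, add_comm]
  have hBH : B.IsHermitian := by
    unfold Matrix.IsHermitian
    rw [hB, conjTranspose_smul, conjTranspose_sub, conjTranspose_conjTranspose]
    simp only [RCLike.star_def, Complex.conj_I, neg_smul, smul_sub]
    abel
  have hLA : L A = L Xᴴ := by rw [hA, map_add, hLX, zero_add]
  have hLB : L B = -(Complex.I • L A) := by
    rw [hLA, hB, map_smul, map_sub, hLX, zero_sub, smul_neg]
  have h1 := (hL.isHermitian_apply hAH).eq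
  have h2 := (hL.isHermitian_apply hBH).eq
  have hLA0 : L A = 0 := by
    rw [hLB, conjTranspose_neg, conjTranspose_smul, h1] at h2
    simp only [RCLike.star_def, Complex.conj_I, neg_smul, neg_neg] at h2
    have h3 : (2 * Complex.I) • L A = 0 := by
      rw [mul_smul, two_smul]
      nth_rewrite 1 [h2]
      simp
    exact (smul_eq_zero.1 h3).resolve_left (by simp)
  by_cases hA0 : A = 0
  · refine ⟨B, hBH, fun hB0 => hX0 ?_, by rw [hLB, hLA0]; simp⟩
    have h3 : X - Xᴴ = 0 := (smul_eq_zero.1 hB0).resolve_left (by simp)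
    have h4 : (2 : ℂ) • X = A + (X - Xᴴ) := by rw [hA, two_smul]; abel
    rw [hA0, h3, add_zero] at h4
    exact (smul_eq_zero.1 h4).resolve_left (by simp)
  · exact ⟨A, hAH, hA0, hLA0⟩

omit [DecidableEq n] in
lemma IsHermitian.trace_conj {X : Matrix n n ℂ} (hX : X.IsHermitian) :
    star X.trace = X.trace := by
  rw [← trace_conjTranspose, hX.eq]

/-- A mixing Lindbladian has exactly one fixed state, and it is close to any state that is nearly
stationary. -/
theorem IsLindbladType.exists_unique_isFixedState [Nonempty n] (hL : IsLindbladType L) {t : ℝ}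
    (ht : IsMixingTime L t) {ρ₀ : Matrix n n ℂ} (hρ₀ : IsState ρ₀) :
    ∃ ρ, IsFixedState L ρ ∧ (∀ ρ', IsFixedState L ρ' → ρ' = ρ) ∧
      traceNorm (ρ - ρ₀) ≤ 2 * t * traceNorm (L ρ₀) := by
  obtain ⟨⟨ht0, hmix⟩, -⟩ := ht
  set P := NormedSpace.exp ((t : ℂ) • L) with hPdef
  have hP : ∀ X : Matrix n n ℂ, X.IsHermitian → X.trace = 0 →
      traceNorm (P X) ≤ 1 / 2 * traceNorm X :=
    fun X hX hX0 => traceNorm_apply_le_half_of_trace_eq_zero hmix hX hX0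
  obtain ⟨A, hA, hA0, hLA⟩ := hL.exists_isHermitian_apply_eq_zero
  have hfixA : ∀ s : ℝ, NormedSpace.exp ((s : ℂ) • L) A = A := fun s =>
    exp_smul_apply_of_apply_eq_zero hLA s
  -- A traceless kernel element would be both fixed and halved in norm.
  have htA : A.trace ≠ 0 := by
    intro h
    have h1 := hP A hA h
    rw [hPdef, hfixA t] at h1
    exact hA0 (eq_zero_of_traceNorm_le_zero (by linarith))
  set X := A.trace⁻¹ • A with hXdef
  have hXH : X.IsHermitian := by
    unfold Matrix.IsHermitian
    rw [hXdef, conjTranspose_smul, hA.eq, star_inv₀, IsHermitian.trace_conj hA]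
  have hXt : X.trace = 1 := by rw [hXdef, trace_smul, smul_eq_mul, inv_mul_cancel₀ htA]
  have hfixX : ∀ s : ℝ, NormedSpace.exp ((s : ℂ) • L) X = X := fun s => by
    rw [hXdef, map_smul, hfixA s]
  -- Positivity of the normalised kernel element `X` is not yet known. The iterates of `ρ₀` keep
  -- trace norm at most one and converge to `X`, so `X` has trace norm at most one, which together
  -- with unit trace makes it a state.
  have hiter : ∀ k : ℕ, traceNorm X ≤ 1 + (1 / 2) ^ k * traceNorm (X - ρ₀) := by
    intro k
    suffices ∃ Y : Matrix n n ℂ, Y.IsHermitian ∧ Y.trace = 1 ∧ traceNorm Y ≤ 1 ∧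
        traceNorm (X - Y) ≤ (1 / 2) ^ k * traceNorm (X - ρ₀) by
      obtain ⟨Y, -, -, hY, hXY⟩ := this
      have := traceNorm_add_le (X - Y) Y
      rw [sub_add_cancel] at this
      linarith
    induction k with
    | zero => exact ⟨ρ₀, hρ₀.1.1, hρ₀.2, hρ₀.traceNorm_le_one, by simp⟩
    | succ k ih =>
      obtain ⟨Y, hY, hYt, hY1, hXY⟩ := ih
      refine ⟨P Y, hL.isHermitian_exp_apply hY t, by rw [hPdef, hL.trace_exp_apply, hYt],
        (hL.traceNorm_exp_apply_le hY ht0).trans hY1, ?_⟩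
      have h1 := hP (X - Y) (hXH.sub hY) (by rw [trace_sub, hXt, hYt, sub_self])
      rw [map_sub, hPdef, hfixX t, ← hPdef] at h1
      rw [pow_succ]
      linarith
  have hX1 : traceNorm X ≤ 1 := by
    refine ge_of_tendsto' (x := atTop) ?_ hiter
    have := (tendsto_pow_atTop_nhds_zero_of_lt_one (by norm_num : (0 : ℝ) ≤ 1 / 2)
      (by norm_num)).mul_const (traceNorm (X - ρ₀))
    simpa using this.const_add 1
  refine ⟨X, ⟨isState_of_traceNorm_le_one hXH hXt hX1, fun s _ => hfixX s⟩, ?_, ?_⟩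
  · rintro ρ' ⟨hρ', hfix⟩
    have h1 := hP (ρ' - X) (hρ'.1.1.sub hXH) (by rw [trace_sub, hXt, hρ'.2, sub_self])
    rw [map_sub, hPdef, hfixX t, hfix t ht0] at h1
    exact sub_eq_zero.1 (eq_zero_of_traceNorm_le_zero (by linarith))
  -- Compare `X` with `ρ₀` through the evolved state: half the distance is absorbed on the left,
  -- whence the factor two.
  · have h1 := hP (X - ρ₀) (hXH.sub hρ₀.1.1) (by rw [trace_sub, hXt, hρ₀.2, sub_self])
    rw [map_sub, hPdef, hfixX t] at h1
    have h2 := hL.traceNorm_exp_apply_sub_le hρ₀.1.1 ht0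
    have h3 := traceNorm_add_le (X - NormedSpace.exp ((t : ℂ) • L) ρ₀)
      (NormedSpace.exp ((t : ℂ) • L) ρ₀ - ρ₀)
    rw [sub_add_sub_cancel] at h3
    linarith

end Semigroup

end OpenSystem

/-! ### Plancherel on an interval, and sinc decay -/

namespace OpenSystem

open Matrix

open MeasureTheory

/-- Unfolding an integral over the line into an integral over one period. -/
lemma lintegral_eq_lintegral_Ioc_tsum {g : ℝ → ENNReal} (hg : Measurable g) {p : ℝ} (hp : 0 < p) :
    ∫⁻ x, g x = ∫⁻ x in Set.Ioc 0 p, ∑' k : ℤ, g (x + k * p) := by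
  rw [lintegral_tsum (f := fun (k : ℤ) x => g (x + k * p))
      fun k => (hg.comp (measurable_add_const _)).aemeasurable,
    ← setLIntegral_univ, ← iUnion_Ioc_add_zsmul hp 0,
    lintegral_iUnion (fun k => measurableSet_Ioc) (Set.pairwise_disjoint_Ioc_add_zsmul 0 p)]
  refine tsum_congr fun k => ?_
  have h := (measurePreserving_add_right volume ((k : ℝ) * p)).setLIntegral_comp_preimage
    (measurableSet_Ioc (a := 0 + k • p) (b := 0 + (k + 1) • p)) hg
  rw [← h]
  congr 2
  ext x
  simp only [Set.mem_preimage, Set.mem_Ioc, zsmul_eq_mul, zero_add, Int.cast_add, Int.cast_one]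
  constructor <;> rintro ⟨h1, h2⟩ <;> constructor <;> linarith

/-- Fourier integral over the symmetric interval of length `T`. -/
noncomputable def intervalFourier (T : ℝ) (h : ℝ → ℂ) (ω : ℝ) : ℂ :=
  ∫ t in (-(T / 2))..(T / 2), Complex.exp (-Complex.I * ω * t) * h t

lemma continuous_intervalFourier (T : ℝ) {h : ℝ → ℂ} (hh : Continuous h) :
    Continuous (intervalFourier T h) := by
  unfold intervalFourier
  refine intervalIntegral.continuous_parametric_intervalIntegral_of_continuous' ?_ _ _
  unfold Function.uncurry
  fun_prop

/-- Sampled at spacing `2π / T`, the transform is, up to the factor `T`, the sequence of Fourier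
coefficients of `t ↦ e^{-iωt} h t` on the interval, and Parseval applies. The modulation does not
change `‖h‖`, so the sum is independent of `ω`. -/
lemma hasSum_sq_intervalFourier {T : ℝ} (hT : 0 < T) {h : ℝ → ℂ} (hh : Continuous h) (ω : ℝ) :
    HasSum (fun k : ℤ => ‖intervalFourier T h (ω + k * (2 * Real.pi / T))‖ ^ 2)
      (T * ∫ t in (-(T / 2))..(T / 2), ‖h t‖ ^ 2) := by
  have hab : -(T / 2) < T / 2 := by linarith
  set q : ℝ → ℂ := fun t => Complex.exp (-Complex.I * ω * t) * h t with hq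
  have hqc : Continuous q := by fun_prop
  have hmem : MemLp q 2 (volume.restrict (Set.Ioc (-(T / 2)) (T / 2))) := by
    rw [memLp_two_iff_integrable_sq_norm hqc.aestronglyMeasurable]
    exact Continuous.integrableOn_Ioc (by fun_prop)
  have key := (hasSum_sq_fourierCoeffOn hab hmem).mul_left (T ^ 2)
  have hlen : T / 2 - -(T / 2) = T := by ring
  have hnorm : ∀ t, ‖q t‖ = ‖h t‖ := by
    intro t
    rw [hq]
    simp only [norm_mul, Complex.norm_exp]
    simp
  simp only [hnorm] at key
  have e1 : (fun k : ℤ => ‖intervalFourier T h (ω + k * (2 * Real.pi / T))‖ ^ 2)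
      = fun k => T ^ 2 * ‖fourierCoeffOn hab q k‖ ^ 2 := by
    funext k
    rw [fourierCoeffOn_eq_integral, norm_smul, mul_pow]
    have : ∫ x in (-(T / 2))..(T / 2), (fourier (-k)) (x : AddCircle (T / 2 - -(T / 2))) • q x
        = intervalFourier T h (ω + k * (2 * Real.pi / T)) := by
      unfold intervalFourier
      refine intervalIntegral.integral_congr fun x _ => ?_
      simp only [fourier_coe_apply, hq, smul_eq_mul]
      rw [← mul_assoc, ← Complex.exp_add]
      congr 2
      push_cast
      have : (T : ℂ) ≠ 0 := by exact_mod_cast hT.ne'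
      field_simp
      ring
    rw [this, hlen, Real.norm_of_nonneg (by positivity)]
    field_simp
  have e2 : T * ∫ t in (-(T / 2))..(T / 2), ‖h t‖ ^ 2
      = T ^ 2 * (T / 2 - -(T / 2))⁻¹ • ∫ t in (-(T / 2))..(T / 2), ‖h t‖ ^ 2 := by
    rw [hlen, smul_eq_mul]
    field_simp
  rw [e1, e2]
  exact key

/-- Plancherel identity for functions supported on an interval. -/
lemma lintegral_sq_intervalFourier {T : ℝ} (hT : 0 < T) {h : ℝ → ℂ} (hh : Continuous h) :
    ∫⁻ ω, ENNReal.ofReal (‖intervalFourier T h ω‖ ^ 2)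
      = ENNReal.ofReal (2 * Real.pi * ∫ t in (-(T / 2))..(T / 2), ‖h t‖ ^ 2) := by
  have hp : 0 < 2 * Real.pi / T := by positivity
  have hc := continuous_intervalFourier T hh
  rw [lintegral_eq_lintegral_Ioc_tsum (by fun_prop) hp]
  -- The sum over translates is constant in `ω`, so integrating over one period multiplies it by `2π
  -- / T`.
  have : ∀ ω : ℝ, ∑' k : ℤ, ENNReal.ofReal
      (‖intervalFourier T h (ω + k * (2 * Real.pi / T))‖ ^ 2)
      = ENNReal.ofReal (T * ∫ t in (-(T / 2))..(T / 2), ‖h t‖ ^ 2) := by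
    intro ω
    have hs := hasSum_sq_intervalFourier hT hh ω
    rw [← hs.tsum_eq, ENNReal.ofReal_tsum_of_nonneg (fun _ => by positivity) hs.summable]
  simp only [this]
  rw [setLIntegral_const, Real.volume_Ioc, ← ENNReal.ofReal_mul']
  · congr 1; field_simp; ring
  · linarith

lemma integrable_sq_intervalFourier {T : ℝ} (hT : 0 < T) {h : ℝ → ℂ} (hh : Continuous h) :
    Integrable fun ω => ‖intervalFourier T h ω‖ ^ 2 := by
  have hc := continuous_intervalFourier T hh
  refine ⟨by fun_prop, ?_⟩
  rw [hasFiniteIntegral_iff_ofReal (by filter_upwards with ω; positivity),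
    lintegral_sq_intervalFourier hT hh]
  exact ENNReal.ofReal_lt_top

lemma integral_sq_intervalFourier {T : ℝ} (hT : 0 < T) {h : ℝ → ℂ} (hh : Continuous h) :
    ∫ ω, ‖intervalFourier T h ω‖ ^ 2
      = 2 * Real.pi * ∫ t in (-(T / 2))..(T / 2), ‖h t‖ ^ 2 := by
  have hc := continuous_intervalFourier T hh
  rw [integral_eq_lintegral_of_nonneg_ae (by filter_upwards with ω; positivity) (by fun_prop),
    lintegral_sq_intervalFourier hT hh, ENNReal.toReal_ofReal]
  refine mul_nonneg (by positivity) ?_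
  exact intervalIntegral.integral_nonneg (by linarith) fun t _ => by positivity

/-- The Fourier integral of a pure phase is a sinc function. -/
lemma norm_sq_intervalFourier_exp_le (T : ℝ) {ν ω : ℝ} (hω : ω ≠ ν) :
    ‖intervalFourier T (fun t => Complex.exp (Complex.I * ν * t)) ω‖ ^ 2 ≤ 4 / (ω - ν) ^ 2 := by
  have hx : ν - ω ≠ 0 := sub_ne_zero.2 hω.symm
  have hc : Complex.I * ((ν - ω : ℝ) : ℂ) ≠ 0 :=
    mul_ne_zero Complex.I_ne_zero (by exact_mod_cast hx)
  have e : intervalFourier T (fun t => Complex.exp (Complex.I * ν * t)) ω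
      = ∫ t in (-(T / 2))..(T / 2), Complex.exp (Complex.I * ((ν - ω : ℝ) : ℂ) * t) := by
    unfold intervalFourier
    refine intervalIntegral.integral_congr fun t _ => ?_
    simp only
    rw [← Complex.exp_add]
    congr 1
    push_cast
    ring
  have h2 : ‖intervalFourier T (fun t => Complex.exp (Complex.I * ν * t)) ω‖ ≤ 2 / |ν - ω| := by
    rw [e, integral_exp_mul_complex hc, norm_div]
    rw [norm_mul, Complex.norm_I, one_mul, Complex.norm_real, Real.norm_eq_abs]
    gcongr
    refine (norm_sub_le _ _).trans ?_
    have : ∀ s : ℝ, ‖Complex.exp (Complex.I * ((ν - ω : ℝ) : ℂ) * s)‖ = 1 := by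
      intro s
      rw [Complex.norm_exp]
      simp
    rw [this, this]
    norm_num
  calc _ ≤ (2 / |ν - ω|) ^ 2 := pow_le_pow_left₀ (norm_nonneg _) h2 2
    _ = 4 / (ω - ν) ^ 2 := by rw [div_pow, sq_abs]; ring

end OpenSystem

/-! ### Heisenberg evolution and the operator Fourier transform -/

namespace OpenSystem

open Matrix

open MeasureTheory

variable {n : Type*} [Fintype n] [DecidableEq n]

section Heisenberg

lemma exp_smul_conj_diagonal {V : Matrix n n ℂ} (hV : Vᴴ * V = 1) (E : n → ℝ) (c : ℂ) :
    NormedSpace.exp (c • (V * diagonal (fun i => (E i : ℂ)) * Vᴴ))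
      = V * diagonal (fun i => Complex.exp (c * E i)) * Vᴴ := by
  have hinv : V⁻¹ = Vᴴ := Matrix.inv_eq_left_inv hV
  have hu : IsUnit V := by
    rw [Matrix.isUnit_iff_isUnit_det]
    exact Matrix.isUnit_det_of_left_inverse hV
  have h := Matrix.exp_conj V (diagonal (fun i => c * (E i : ℂ))) hu
  rw [Matrix.exp_diagonal, hinv] at h
  have e : c • (V * diagonal (fun i => (E i : ℂ)) * Vᴴ)
      = V * diagonal (fun i => c * (E i : ℂ)) * Vᴴ := by
    rw [← smul_mul_assoc, ← mul_smul_comm, ← diagonal_smul]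
    rfl
  rw [e, h]
  congr 3
  ext i
  rw [Pi.coe_exp, Complex.exp_eq_exp_ℂ]

variable {V : Matrix n n ℂ} {E : n → ℝ} {H : Matrix n n ℂ}

/-- In an energy basis each matrix entry merely rotates at its Bohr frequency `E i - E j`. -/
lemma heisenberg_eq (hV : Vᴴ * V = 1) (hH : H = V * diagonal (fun i => (E i : ℂ)) * Vᴴ)
    (A : Matrix n n ℂ) (t : ℝ) :
    heisenberg H A t = V * Matrix.of (fun i j => (Vᴴ * A * V) i j *
      Complex.exp (Complex.I * ((E i - E j : ℝ) : ℂ) * t)) * Vᴴ := by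
  have e : Matrix.of (fun i j => (Vᴴ * A * V) i j *
      Complex.exp (Complex.I * ((E i - E j : ℝ) : ℂ) * t))
      = diagonal (fun i => Complex.exp (Complex.I * t * E i)) * (Vᴴ * A * V)
        * diagonal (fun i => Complex.exp (-Complex.I * t * E i)) := by
    ext i j
    have key : Complex.exp (Complex.I * ((E i - E j : ℝ) : ℂ) * t)
        = Complex.exp (Complex.I * t * E i) * Complex.exp (-Complex.I * t * E j) := by
      rw [← Complex.exp_add]
      congr 1
      push_cast
      ring
    rw [mul_diagonal, diagonal_mul, of_apply, key]
    ring
  rw [heisenberg, hH, exp_smul_conj_diagonal hV, exp_smul_conj_diagonal hV, e]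
  simp only [Matrix.mul_assoc]

lemma continuous_heisenberg (hH : H.IsHermitian) (A : Matrix n n ℂ) :
    Continuous (heisenberg H A) := by
  obtain ⟨V, hV, -, hd⟩ := exists_unitary_diagonal hH
  have : heisenberg H A = fun t : ℝ => V * Matrix.of (fun i j => (Vᴴ * A * V) i j *
      Complex.exp (Complex.I * ((hH.eigenvalues i - hH.eigenvalues j : ℝ) : ℂ) * t)) * Vᴴ :=
    funext fun t => heisenberg_eq hV hd A t
  rw [this]
  refine Continuous.matrix_mul (Continuous.matrix_mul continuous_const ?_) continuous_const
  exact continuous_matrix fun i j => by simp only [of_apply]; fun_prop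

lemma exp_smul_unitary (hH : H.IsHermitian) (t : ℝ) {s : ℂ} (hs : s = Complex.I ∨ s = -Complex.I) :
    (NormedSpace.exp ((s * t) • H))ᴴ * NormedSpace.exp ((s * t) • H) = 1 := by
  have h0 : star (s * t) • H + (s * t) • H = 0 := by
    rw [← add_smul]
    rcases hs with rfl | rfl <;> simp
  have h : (NormedSpace.exp ((s * t) • H))ᴴ = NormedSpace.exp (star (s * t) • H) := by
    rw [← Matrix.exp_conjTranspose, conjTranspose_smul, hH.eq]
  rw [h, ← Matrix.exp_add_of_commute, h0, NormedSpace.exp_zero]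
  exact ((Commute.refl H).smul_left _).smul_right _

lemma heisenberg_conjTranspose (hH : H.IsHermitian) (A : Matrix n n ℂ) (t : ℝ) :
    (heisenberg H A t)ᴴ = heisenberg H Aᴴ t := by
  rw [heisenberg, heisenberg, conjTranspose_mul, conjTranspose_mul, ← Matrix.exp_conjTranspose,
    ← Matrix.exp_conjTranspose, conjTranspose_smul, conjTranspose_smul, hH.eq, Matrix.mul_assoc]
  simp

/-- The sum is `Tr (W† S W)` with `S = ∑ A† A`. Writing `S = B† B` gives `‖B‖² = ‖S‖ ≤ 1`. -/
lemma sum_hsSq_mul_le {ι : Type*} [Fintype ι] {A : ι → Matrix n n ℂ}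
    (hA : ‖∑ a, (A a)ᴴ * A a‖ ≤ 1) (W : Matrix n n ℂ) : ∑ a, hsSq (A a * W) ≤ hsSq W := by
  have hS : (∑ a, (A a)ᴴ * A a).PosSemidef :=
    Matrix.posSemidef_sum _ fun a _ => Matrix.posSemidef_conjTranspose_mul_self (A a)
  obtain ⟨B, hB⟩ := exists_eq_conjTranspose_mul_self hS
  have e : ∑ a, hsSq (A a * W) = hsSq (B * W) := by
    have : ((∑ a, hsSq (A a * W) : ℝ) : ℂ) = ((hsSq (B * W) : ℝ) : ℂ) := by
      push_cast
      simp only [hsSq_eq_trace]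
      have h2 : ∀ C : Matrix n n ℂ, (C * W)ᴴ * (C * W) = Wᴴ * (Cᴴ * C) * W := fun C => by
        rw [conjTranspose_mul]; simp only [Matrix.mul_assoc]
      simp only [h2]
      rw [← hB, ← trace_sum, Matrix.mul_sum, Matrix.sum_mul]
    exact_mod_cast this
  rw [e]
  refine (hsSq_mul_le B W).trans (mul_le_of_le_one_left (hsSq_nonneg _) ?_)
  rw [hB, Matrix.l2_opNorm_conjTranspose_mul_self] at hA
  nlinarith

lemma sum_hsSq_heisenberg_mul_le {ι : Type*} [Fintype ι] (hH : H.IsHermitian)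
    {A : ι → Matrix n n ℂ} (hA : ‖∑ a, (A a)ᴴ * A a‖ ≤ 1) (W : Matrix n n ℂ) (t : ℝ) :
    ∑ a, hsSq (heisenberg H (A a) t * W) ≤ hsSq W := by
  have h1 := exp_smul_unitary hH t (Or.inl rfl)
  have h2 := exp_smul_unitary hH t (Or.inr rfl)
  have : ∀ a, hsSq (heisenberg H (A a) t * W)
      = hsSq (A a * (NormedSpace.exp ((-Complex.I * t) • H) * W)) := fun a => by
    rw [heisenberg, Matrix.mul_assoc, Matrix.mul_assoc, hsSq_unitary_mul h1]
  simp only [this]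
  exact (sum_hsSq_mul_le hA _).trans_eq (hsSq_unitary_mul h2 W)

end Heisenberg

section OperatorFourier

variable {H : Matrix n n ℂ} {T : ℝ}

lemma windowFilter_eq_indicator (T : ℝ) :
    windowFilter T = Set.indicator (Set.Icc (-(T / 2)) (T / 2)) fun _ => 1 / √T := by
  funext t
  simp only [windowFilter, Set.indicator, Set.mem_Icc, abs_le]

/-- Matrix entries of the operator Fourier transform, after multiplication by fixed matrices. -/
lemma mul_operatorFourier_mul_apply (hH : H.IsHermitian) (hT : 0 < T) (A P Q : Matrix n n ℂ)
    (ω : ℝ) (i j : n) :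
    (P * operatorFourier (windowFilter T) H A ω * Q) i j
      = ((1 / √(2 * Real.pi) * (1 / √T) : ℝ) : ℂ) *
        intervalFourier T (fun t => (P * heisenberg H A t * Q) i j) ω := by
  have hc := continuous_heisenberg hH A
  let φ : Matrix n n ℂ →L[ℂ] ℂ := LinearMap.toContinuousLinearMap
    { toFun := fun M => (P * M * Q) i j
      map_add' := fun M N => by simp [Matrix.mul_add, Matrix.add_mul]
      map_smul' := fun c M => by simp }
  have hφ : ∀ M, φ M = (P * M * Q) i j := fun M => rfl
  set F : ℝ → Matrix n n ℂ := fun t =>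
    (Complex.exp (-Complex.I * ω * t) * ((1 / √T : ℝ) : ℂ)) • heisenberg H A t with hF
  have hFc : Continuous F := by
    have h1 : Continuous fun t : ℝ => Complex.exp (-Complex.I * ω * t) * ((1 / √T : ℝ) : ℂ) := by
      fun_prop
    exact h1.smul hc
  have e : (fun t : ℝ => (Complex.exp (-Complex.I * ω * t) * (windowFilter T t : ℂ)) •
      heisenberg H A t) = Set.indicator (Set.Icc (-(T / 2)) (T / 2)) F := by
    funext t
    rw [windowFilter_eq_indicator]
    by_cases h : t ∈ Set.Icc (-(T / 2)) (T / 2)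
    · simp only [Set.indicator_of_mem h, hF]
    · simp only [Set.indicator_of_notMem h, Complex.ofReal_zero, mul_zero, zero_smul]
  rw [operatorFourier, e, ← hφ, map_smul, integral_indicator measurableSet_Icc,
    ← ContinuousLinearMap.integral_comp_comm φ
      (hFc.continuousOn.integrableOn_compact isCompact_Icc),
    integral_Icc_eq_integral_Ioc, ← intervalIntegral.integral_of_le (by linarith)]
  rw [smul_eq_mul, Complex.ofReal_mul, mul_assoc]
  congr 1
  rw [intervalFourier, ← intervalIntegral.integral_const_mul]
  refine intervalIntegral.integral_congr fun t _ => ?_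
  simp only [hF, hφ]
  rw [Matrix.mul_smul, Matrix.smul_mul, Matrix.smul_apply, smul_eq_mul]
  ring

lemma continuous_operatorFourier (hH : H.IsHermitian) (hT : 0 < T) (A : Matrix n n ℂ) :
    Continuous (operatorFourier (windowFilter T) H A) := by
  refine continuous_matrix fun i j => ?_
  have := fun ω => mul_operatorFourier_mul_apply hH hT A 1 1 ω i j
  simp only [Matrix.one_mul, Matrix.mul_one] at this
  simp only [this]
  refine continuous_const.mul (continuous_intervalFourier T ?_)
  exact (continuous_heisenberg hH A).matrix_elem i j

/-- The window is real, so conjugation only reverses the frequency. This is what lets the gain term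
be time-reversed when the jumps are closed under adjoints. -/
lemma operatorFourier_conjTranspose (hH : H.IsHermitian) (hT : 0 < T) (A : Matrix n n ℂ)
    (ω : ℝ) :
    (operatorFourier (windowFilter T) H A ω)ᴴ = operatorFourier (windowFilter T) H Aᴴ (-ω) := by
  ext i j
  have h1 := mul_operatorFourier_mul_apply hH hT A 1 1 ω j i
  have h2 := mul_operatorFourier_mul_apply hH hT Aᴴ 1 1 (-ω) i j
  simp only [Matrix.one_mul, Matrix.mul_one] at h1 h2
  rw [conjTranspose_apply, h1, h2, star_mul', RCLike.star_def,
    Complex.conj_ofReal]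
  congr 1
  rw [intervalFourier, intervalFourier, intervalIntegral.integral_of_le (by linarith),
    intervalIntegral.integral_of_le (by linarith), ← integral_conj]
  refine integral_congr_ae (Filter.Eventually.of_forall fun t => ?_)
  simp only [map_mul, ← Complex.exp_conj, ← heisenberg_conjTranspose hH, conjTranspose_apply]
  simp

lemma norm_sq_mul_operatorFourier_mul_apply (hH : H.IsHermitian) (hT : 0 < T)
    (A P Q : Matrix n n ℂ) (ω : ℝ) (i j : n) :
    ‖(P * operatorFourier (windowFilter T) H A ω * Q) i j‖ ^ 2
      = 1 / (2 * Real.pi * T) *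
        ‖intervalFourier T (fun t => (P * heisenberg H A t * Q) i j) ω‖ ^ 2 := by
  rw [mul_operatorFourier_mul_apply hH hT, norm_mul, mul_pow, Complex.norm_real, Real.norm_eq_abs,
    sq_abs, mul_pow, div_pow, div_pow, Real.sq_sqrt (by positivity), Real.sq_sqrt hT.le]
  congr 1
  field_simp

lemma continuous_heisenberg_mul_apply (hH : H.IsHermitian) (A W : Matrix n n ℂ) (i j : n) :
    Continuous fun t => (heisenberg H A t * W) i j :=
  ((continuous_heisenberg hH A).matrix_mul continuous_const).matrix_elem i j

lemma hsSq_operatorFourier_mul (hH : H.IsHermitian) (hT : 0 < T) (A W : Matrix n n ℂ) (ω : ℝ) :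
    hsSq (operatorFourier (windowFilter T) H A ω * W)
      = ∑ i, ∑ j, 1 / (2 * Real.pi * T) *
        ‖intervalFourier T (fun t => (heisenberg H A t * W) i j) ω‖ ^ 2 := by
  unfold hsSq
  refine Finset.sum_congr rfl fun i _ => Finset.sum_congr rfl fun j _ => ?_
  have := norm_sq_mul_operatorFourier_mul_apply hH hT A 1 W ω i j
  simpa only [Matrix.one_mul] using this

lemma integrable_hsSq_operatorFourier_mul (hH : H.IsHermitian) (hT : 0 < T)
    (A W : Matrix n n ℂ) :
    Integrable fun ω => hsSq (operatorFourier (windowFilter T) H A ω * W) := by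
  simp only [hsSq_operatorFourier_mul hH hT]
  exact integrable_finsetSum _ fun i _ => integrable_finsetSum _ fun j _ =>
    (integrable_sq_intervalFourier hT (continuous_heisenberg_mul_apply hH A W i j)).const_mul _

lemma integral_hsSq_operatorFourier_mul (hH : H.IsHermitian) (hT : 0 < T)
    (A W : Matrix n n ℂ) :
    ∫ ω, hsSq (operatorFourier (windowFilter T) H A ω * W)
      = 1 / T * ∫ t in (-(T / 2))..(T / 2), hsSq (heisenberg H A t * W) := by
  have hc := continuous_heisenberg_mul_apply hH A W
  have hc2 : ∀ i j, Continuous fun t => ‖(heisenberg H A t * W) i j‖ ^ 2 :=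
    fun i j => (hc i j).norm.pow 2
  simp only [hsSq_operatorFourier_mul hH hT]
  rw [integral_finsetSum _ fun i _ => integrable_finsetSum _ fun j _ =>
    (integrable_sq_intervalFourier hT (hc i j)).const_mul _]
  unfold hsSq
  rw [intervalIntegral.integral_finsetSum fun i _ => Continuous.intervalIntegrable
    (continuous_finsetSum _ fun j _ => hc2 i j) _ _, Finset.mul_sum]
  refine Finset.sum_congr rfl fun i _ => ?_
  rw [integral_finsetSum _ fun j _ =>
    (integrable_sq_intervalFourier hT (hc i j)).const_mul _,
    intervalIntegral.integral_finsetSum fun j _ => Continuous.intervalIntegrable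
    (hc2 i j) _ _, Finset.mul_sum]
  refine Finset.sum_congr rfl fun j _ => ?_
  rw [integral_const_mul, integral_sq_intervalFourier hT (hc i j)]
  field_simp

/-- Plancherel bound for a normalised family of jump operators. -/
lemma sum_integral_hsSq_operatorFourier_mul_le {ι : Type*} [Fintype ι] (hH : H.IsHermitian)
    (hT : 0 < T) {A : ι → Matrix n n ℂ} (hA : ‖∑ a, (A a)ᴴ * A a‖ ≤ 1) (W : Matrix n n ℂ) :
    ∑ a, ∫ ω, hsSq (operatorFourier (windowFilter T) H (A a) ω * W) ≤ hsSq W := by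
  simp only [integral_hsSq_operatorFourier_mul hH hT]
  have hc : ∀ a, Continuous fun t => hsSq (heisenberg H (A a) t * W) := fun a => by
    unfold hsSq
    exact continuous_finsetSum _ fun i _ => continuous_finsetSum _ fun j _ =>
      (continuous_heisenberg_mul_apply hH (A a) W i j).norm.pow 2
  rw [← Finset.mul_sum, ← intervalIntegral.integral_finsetSum fun a _ =>
    (hc a).intervalIntegrable _ _]
  -- After Plancherel the quantity is a time average over a window of length `T`, and its integrand
  -- is at most `hsSq W` at every time.
  have h := intervalIntegral.integral_mono_on (a := -(T / 2)) (b := T / 2) (by linarith)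
    ((continuous_finsetSum Finset.univ fun a _ => hc a).intervalIntegrable (μ := volume) _ _)
    (continuous_const (y := hsSq W) |>.intervalIntegrable _ _)
    fun t _ => sum_hsSq_heisenberg_mul_le hH hA W t
  rw [intervalIntegral.integral_const, smul_eq_mul] at h
  rw [one_div, inv_mul_le_iff₀ hT]
  linarith

/-- In an eigenbasis of `H`, the operator Fourier transform decays away from the Bohr
frequencies. -/
lemma norm_sq_conj_operatorFourier_apply_mul_le (hH : H.IsHermitian) (hT : 0 < T)
    {V : Matrix n n ℂ} {E : n → ℝ} (hV : Vᴴ * V = 1)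
    (hd : H = V * diagonal (fun i => (E i : ℂ)) * Vᴴ) (A : Matrix n n ℂ) (ω : ℝ) (i j : n) :
    ‖(Vᴴ * operatorFourier (windowFilter T) H A ω * V) i j‖ ^ 2 * (ω - (E i - E j)) ^ 2
      ≤ 2 / (Real.pi * T) * ‖(Vᴴ * A * V) i j‖ ^ 2 := by
  -- At resonance the sinc bound is unavailable, but the factor `(ω - ν)²` vanishes.
  rcases eq_or_ne ω (E i - E j) with rfl | hω
  · simp only [sub_self]
    have := Real.pi_pos
    rw [zero_pow two_ne_zero, mul_zero]
    positivity
  · have e : (fun t : ℝ => (Vᴴ * heisenberg H A t * V) i j) = fun t : ℝ => (Vᴴ * A * V) i j *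
        Complex.exp (Complex.I * ((E i - E j : ℝ) : ℂ) * t) := by
      funext t
      rw [heisenberg_eq hV hd]
      have : ∀ M : Matrix n n ℂ, Vᴴ * (V * M * Vᴴ) * V = M := fun M => by
        calc Vᴴ * (V * M * Vᴴ) * V = (Vᴴ * V) * M * (Vᴴ * V) := by simp only [Matrix.mul_assoc]
          _ = M := by rw [hV, Matrix.one_mul, Matrix.mul_one]
      rw [this, of_apply]
    have e2 : intervalFourier T (fun t : ℝ => (Vᴴ * A * V) i j *
        Complex.exp (Complex.I * ((E i - E j : ℝ) : ℂ) * t)) ω = (Vᴴ * A * V) i j *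
        intervalFourier T (fun t : ℝ => Complex.exp (Complex.I * ((E i - E j : ℝ) : ℂ) * t)) ω := by
      unfold intervalFourier
      rw [← intervalIntegral.integral_const_mul]
      refine intervalIntegral.integral_congr fun t _ => ?_
      simp only
      ring
    rw [norm_sq_mul_operatorFourier_mul_apply hH hT, e, e2, norm_mul, mul_pow]
    have h := norm_sq_intervalFourier_exp_le T hω
    have hx : 0 < (ω - (E i - E j)) ^ 2 := by
      have := sub_ne_zero.2 hω
      positivity
    rw [le_div_iff₀ hx] at h
    have hpi := Real.pi_pos
    calc _ = 1 / (2 * Real.pi * T) * ‖(Vᴴ * A * V) i j‖ ^ 2 *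
          (‖intervalFourier T (fun t : ℝ =>
            Complex.exp (Complex.I * ((E i - E j : ℝ) : ℂ) * t)) ω‖ ^ 2
            * (ω - (E i - E j)) ^ 2) := by ring
      _ ≤ 1 / (2 * Real.pi * T) * ‖(Vᴴ * A * V) i j‖ ^ 2 * 4 := by gcongr
      _ = _ := by field_simp; ring

end OperatorFourier

end OpenSystem

/-! ### The coarse-grained generator is of Lindblad type -/

namespace OpenSystem

open Matrix

open MeasureTheory

variable {n : Type*} [Fintype n] [DecidableEq n]

lemma norm_sq_le_hsSq (K : Matrix n n ℂ) : ‖K‖ ^ 2 ≤ hsSq K := by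
  suffices h : ‖K‖ ≤ √(hsSq K) by
    calc ‖K‖ ^ 2 ≤ √(hsSq K) ^ 2 := pow_le_pow_left₀ (norm_nonneg _) h 2
      _ = hsSq K := Real.sq_sqrt (hsSq_nonneg _)
  rw [Matrix.l2_opNorm_def]
  refine ContinuousLinearMap.opNorm_le_bound _ (Real.sqrt_nonneg _) fun x => ?_
  refine le_of_sq_le_sq ?_ (by positivity)
  rw [mul_pow, Real.sq_sqrt (hsSq_nonneg _), EuclideanSpace.norm_sq_eq, EuclideanSpace.norm_sq_eq,
    hsSq, Finset.sum_mul]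
  refine Finset.sum_le_sum fun i _ => ?_
  change ‖(K *ᵥ x.ofLp) i‖ ^ 2 ≤ _
  rw [Matrix.mulVec, dotProduct]
  refine (pow_le_pow_left₀ (norm_nonneg _) (norm_sum_le _ _) 2).trans ?_
  simp only [norm_mul]
  exact Finset.sum_mul_sq_le_sq_mul_sq _ _ _

lemma dissipator_apply (K X : Matrix n n ℂ) :
    dissipator K X = K * X * Kᴴ - (1 / 2 : ℂ) • (Kᴴ * K * X + X * (Kᴴ * K)) := rfl

lemma continuous_clm_of_forall_apply {M E : Type*} [TopologicalSpace M] [NormedAddCommGroup E]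
    [NormedSpace ℂ E] [FiniteDimensional ℂ E] {f : M → E →L[ℂ] E}
    (h : ∀ y, Continuous fun x => f x y) : Continuous f :=
  continuous_clm_apply.2 h

lemma continuous_dissipator :
    Continuous (dissipator : Matrix n n ℂ → Matrix n n ℂ →L[ℂ] Matrix n n ℂ) := by
  have h : ∀ X : Matrix n n ℂ, Continuous fun K : Matrix n n ℂ =>
      K * X * Kᴴ - (1 / 2 : ℂ) • (Kᴴ * K * X + X * (Kᴴ * K)) := fun X => by
    have h0 : Continuous fun K : Matrix n n ℂ => Kᴴ * K :=
      continuous_id.matrix_conjTranspose.matrix_mul continuous_id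
    have h1 : Continuous fun K : Matrix n n ℂ => K * X * Kᴴ :=
      (continuous_id.matrix_mul continuous_const).matrix_mul continuous_id.matrix_conjTranspose
    have h2 : Continuous fun K : Matrix n n ℂ => Kᴴ * K * X + X * (Kᴴ * K) :=
      (h0.matrix_mul continuous_const).add (continuous_const.matrix_mul h0)
    exact h1.sub (h2.const_smul (1 / 2 : ℂ))
  exact continuous_clm_of_forall_apply (E := Matrix n n ℂ) h

lemma norm_mul_mul_conjTranspose_le (K X : Matrix n n ℂ) :
    ‖K * X * Kᴴ‖ ≤ ‖X‖ * ‖K‖ ^ 2 := by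
  calc ‖K * X * Kᴴ‖ ≤ ‖K‖ * ‖X‖ * ‖Kᴴ‖ :=
        (norm_mul_le _ _).trans (mul_le_mul_of_nonneg_right (norm_mul_le _ _) (norm_nonneg _))
    _ = ‖X‖ * ‖K‖ ^ 2 := by rw [Matrix.l2_opNorm_conjTranspose]; ring

lemma norm_conjTranspose_mul_self_le (K : Matrix n n ℂ) : ‖Kᴴ * K‖ ≤ 1 * ‖K‖ ^ 2 := by
  rw [Matrix.l2_opNorm_conjTranspose_mul_self, one_mul, sq]

lemma norm_dissipator_le (K : Matrix n n ℂ) : ‖dissipator K‖ ≤ 2 * ‖K‖ ^ 2 := by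
  refine ContinuousLinearMap.opNorm_le_bound _ (by positivity) fun X => ?_
  rw [dissipator_apply]
  have h1 := norm_mul_mul_conjTranspose_le K X
  have h0 := norm_conjTranspose_mul_self_le K
  have h2 : ‖Kᴴ * K * X‖ ≤ 1 * ‖K‖ ^ 2 * ‖X‖ :=
    (norm_mul_le _ _).trans (mul_le_mul_of_nonneg_right h0 (norm_nonneg _))
  have h3 : ‖X * (Kᴴ * K)‖ ≤ ‖X‖ * (1 * ‖K‖ ^ 2) :=
    (norm_mul_le _ _).trans (mul_le_mul_of_nonneg_left h0 (norm_nonneg _))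
  refine (norm_sub_le _ _).trans ?_
  rw [norm_smul]
  have h4 := norm_add_le (Kᴴ * K * X) (X * (Kᴴ * K))
  have h5 : ‖(1 / 2 : ℂ)‖ = 1 / 2 := by norm_num
  rw [h5]
  nlinarith

/-- The integral of a family of positive semidefinite matrices is positive semidefinite. -/
lemma posSemidef_integral {F : ℝ → Matrix n n ℂ} (hF : Integrable F)
    (h : ∀ ω, (F ω).PosSemidef) : (∫ ω, F ω).PosSemidef := by
  refine PosSemidef.of_dotProduct_mulVec_nonneg ?_ fun x => ?_
  · let φ : Matrix n n ℂ →L[ℝ] Matrix n n ℂ := LinearMap.toContinuousLinearMap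
      { toFun := fun M => Mᴴ
        map_add' := fun M N => conjTranspose_add M N
        map_smul' := fun c M => by simp [conjTranspose_smul] }
    have h1 : φ (∫ ω, F ω) = ∫ ω, φ (F ω) := (φ.integral_comp_comm hF).symm
    change φ (∫ ω, F ω) = _
    rw [h1]
    exact integral_congr_ae (Filter.Eventually.of_forall fun ω => (h ω).1)
  · let ψ : Matrix n n ℂ →L[ℂ] ℂ := LinearMap.toContinuousLinearMap
      { toFun := fun M => star x ⬝ᵥ M *ᵥ x
        map_add' := fun M N => by rw [add_mulVec, dotProduct_add]
        map_smul' := fun c M => by rw [smul_mulVec, dotProduct_smul]; rfl }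
    have h1 : ψ (∫ ω, F ω) = ∫ ω, ψ (F ω) := (ψ.integral_comp_comm hF).symm
    change 0 ≤ ψ (∫ ω, F ω)
    rw [h1]
    have h2 : ∀ ω, ψ (F ω) = (((ψ (F ω)).re : ℝ) : ℂ) := fun ω => by
      have := Complex.le_def.1 ((h ω).dotProduct_mulVec_nonneg x)
      exact Complex.ext rfl this.2.symm
    rw [integral_congr_ae (Filter.Eventually.of_forall h2), integral_complex_ofReal]
    refine Complex.zero_le_real.2 (integral_nonneg fun ω => ?_)
    exact (Complex.le_def.1 ((h ω).dotProduct_mulVec_nonneg x)).1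

section Lindbladian

variable {H : Matrix n n ℂ} {T : ℝ} {γ : ℝ → ℝ}

/-- Anything growing at most quadratically in the jump operator is dominated by its squared
Hilbert–Schmidt norm, integrable by Plancherel. This covers the dissipator and the gain and loss
terms alike. -/
lemma integrable_smul_comp_operatorFourier {F : Type*} [NormedAddCommGroup F] [NormedSpace ℂ F]
    (hH : H.IsHermitian) (hT : 0 < T) (hγm : Measurable γ) (hγ : ∀ ω, 0 ≤ γ ω ∧ γ ω ≤ 1)
    (A : Matrix n n ℂ) {B : Matrix n n ℂ → F} (hBc : Continuous B) {c : ℝ}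
    (hB : ∀ K, ‖B K‖ ≤ c * ‖K‖ ^ 2) :
    Integrable fun ω => (γ ω : ℂ) • B (operatorFourier (windowFilter T) H A ω) := by
  have hi := (integrable_hsSq_operatorFourier_mul hH hT A 1).const_mul |c|
  simp only [Matrix.mul_one] at hi
  refine hi.mono' ?_ (Filter.Eventually.of_forall fun ω => ?_)
  · refine AEStronglyMeasurable.smul ?_
      (hBc.comp (continuous_operatorFourier hH hT A)).aestronglyMeasurable
    exact (Complex.measurable_ofReal.comp hγm).aestronglyMeasurable
  · rw [norm_smul, Complex.norm_real, Real.norm_of_nonneg (hγ ω).1]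
    calc γ ω * ‖B (operatorFourier (windowFilter T) H A ω)‖
        ≤ 1 * (|c| * ‖operatorFourier (windowFilter T) H A ω‖ ^ 2) := by
          refine mul_le_mul (hγ ω).2 ((hB _).trans ?_) (norm_nonneg _) zero_le_one
          exact mul_le_mul_of_nonneg_right (le_abs_self c) (by positivity)
      _ ≤ _ := by
          rw [one_mul]
          exact mul_le_mul_of_nonneg_left (norm_sq_le_hsSq _) (abs_nonneg c)

variable {ι : Type*} [Fintype ι]

lemma lindbladian_apply (hH : H.IsHermitian) (hT : 0 < T) (hγm : Measurable γ)
    (hγ : ∀ ω, 0 ≤ γ ω ∧ γ ω ≤ 1) (A : ι → Matrix n n ℂ) (X : Matrix n n ℂ) :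
    lindbladian (windowFilter T) γ H A X
      = ∑ a, ∫ ω, (γ ω : ℂ) • dissipator (operatorFourier (windowFilter T) H (A a) ω) X := by
  have hi : ∀ a, Integrable fun ω =>
      (γ ω : ℂ) • dissipator (operatorFourier (windowFilter T) H (A a) ω) := fun a =>
    integrable_smul_comp_operatorFourier (F := Matrix n n ℂ →L[ℂ] Matrix n n ℂ) (B := dissipator)
      hH hT hγm hγ (A a) continuous_dissipator norm_dissipator_le
  rw [lindbladian, _root_.sum_apply]
  exact Finset.sum_congr rfl fun a _ => ContinuousLinearMap.integral_apply (hi a) X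

/-- The coarse-grained master equation is of Lindblad type. -/
lemma isLindbladType_lindbladian (hH : H.IsHermitian) (hT : 0 < T) (hγm : Measurable γ)
    (hγ : ∀ ω, 0 ≤ γ ω ∧ γ ω ≤ 1) (A : ι → Matrix n n ℂ) :
    IsLindbladType (lindbladian (windowFilter T) γ H A) := by
  set K : ι → ℝ → Matrix n n ℂ := fun a => operatorFourier (windowFilter T) H (A a) with hK
  have i1 : ∀ a X, Integrable fun ω => (γ ω : ℂ) • (K a ω * X * (K a ω)ᴴ) := fun a X =>
    integrable_smul_comp_operatorFourier (B := fun M => M * X * Mᴴ) hH hT hγm hγ (A a)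
      (by fun_prop) fun M => norm_mul_mul_conjTranspose_le M X
  have i2 : ∀ a, Integrable fun ω => (γ ω : ℂ) • ((K a ω)ᴴ * K a ω) := fun a =>
    integrable_smul_comp_operatorFourier (B := fun M => Mᴴ * M) hH hT hγm hγ (A a)
      (by fun_prop) norm_conjTranspose_mul_self_le
  have hγ0 : ∀ ω, (0 : ℂ) ≤ (γ ω : ℂ) := fun ω => Complex.zero_le_real.2 (hγ ω).1
  have hcomm : ∀ (φ : Matrix n n ℂ →ₗ[ℂ] Matrix n n ℂ) (F : ℝ → Matrix n n ℂ), Integrable F →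
      φ (∫ ω, F ω) = ∫ ω, φ (F ω) := fun φ F hF =>
    ((LinearMap.toContinuousLinearMap φ).integral_comp_comm hF).symm
  have hcommi : ∀ (φ : Matrix n n ℂ →ₗ[ℂ] Matrix n n ℂ) (F : ℝ → Matrix n n ℂ), Integrable F →
      Integrable fun ω => φ (F ω) := fun φ F hF =>
    (LinearMap.toContinuousLinearMap φ).integrable_comp hF
  have hcomm' : ∀ (φ : Matrix n n ℂ →ₗ[ℂ] ℂ) (F : ℝ → Matrix n n ℂ), Integrable F →
      φ (∫ ω, F ω) = ∫ ω, φ (F ω) := fun φ F hF =>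
    ((LinearMap.toContinuousLinearMap φ).integral_comp_comm hF).symm
  refine ⟨fun X => ∑ a, ∫ ω, (γ ω : ℂ) • (K a ω * X * (K a ω)ᴴ),
    ∑ a, ∫ ω, (γ ω : ℂ) • ((K a ω)ᴴ * K a ω), ?_, ?_, ?_, ?_⟩
  · exact (posSemidef_sum _ fun a _ => posSemidef_integral (i2 a) fun ω =>
      (posSemidef_conjTranspose_mul_self (K a ω)).smul (hγ0 ω)).1
  · intro P hP
    exact posSemidef_sum _ fun a _ => posSemidef_integral (i1 a P) fun ω =>
      (hP.mul_mul_conjTranspose_same (K a ω)).smul (hγ0 ω)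
  · intro X
    rw [trace_sum, Finset.sum_mul, trace_sum]
    refine Finset.sum_congr rfl fun a _ => ?_
    have h1 := hcomm' (Matrix.traceLinearMap n ℂ ℂ) _ (i1 a X)
    have h2 := hcomm' (Matrix.traceLinearMap n ℂ ℂ ∘ₗ LinearMap.mulRight ℂ X) _ (i2 a)
    refine h1.trans (Eq.trans ?_ h2.symm)
    refine integral_congr_ae (Filter.Eventually.of_forall fun ω => ?_)
    change ((γ ω : ℂ) • (K a ω * X * (K a ω)ᴴ)).trace = ((γ ω : ℂ) • ((K a ω)ᴴ * K a ω) * X).trace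
    rw [smul_mul_assoc, trace_smul, trace_smul, Matrix.trace_mul_comm (K a ω * X),
      ← Matrix.mul_assoc]
  · intro X
    rw [lindbladian_apply hH hT hγm hγ, Finset.sum_mul, Finset.mul_sum, ← Finset.sum_add_distrib,
      Finset.smul_sum, ← Finset.sum_sub_distrib]
    refine Finset.sum_congr rfl fun a _ => ?_
    let φ : Matrix n n ℂ →ₗ[ℂ] Matrix n n ℂ :=
      (1 / 2 : ℂ) • (LinearMap.mulRight ℂ X + LinearMap.mulLeft ℂ X)
    have hφ : ∀ M, φ M = (1 / 2 : ℂ) • (M * X + X * M) := fun M => rfl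
    rw [← hφ, hcomm φ _ (i2 a), ← integral_sub (i1 a X) (hcommi φ _ (i2 a))]
    refine integral_congr_ae (Filter.Eventually.of_forall fun ω => ?_)
    simp only [hφ, dissipator_apply, smul_sub, hK, smul_mul_assoc, mul_smul_comm, ← smul_add,
      smul_comm (1 / 2 : ℂ)]

end Lindbladian

end OpenSystem

/-! ### Approximate detailed balance -/

namespace OpenSystem

open Matrix

open MeasureTheory

/-- The left side is at most `min(1, y²)`. The rational majorant is chosen so that its numerator
cancels the `1 / (ω - ν)²` decay of the jump operator and an integrable Lorentzian remains. -/
lemma one_sub_exp_neg_sq_le {y : ℝ} (hy : 0 ≤ y) :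
    (1 - Real.exp (-y)) ^ 2 ≤ 2 * y ^ 2 / (1 + y ^ 2) := by
  have h1 : 0 ≤ 1 - Real.exp (-y) := by
    have := Real.exp_le_one_iff.2 (neg_nonpos.2 hy)
    linarith
  have h2 : 1 - Real.exp (-y) ≤ 1 := by linarith [Real.exp_pos (-y)]
  have h3 : 1 - Real.exp (-y) ≤ y := by linarith [Real.add_one_le_exp (-y)]
  rw [le_div_iff₀ (by positivity)]
  nlinarith [mul_le_mul h3 h3 h1 hy, mul_le_mul h2 h2 h1 zero_le_one,
    mul_nonneg (sq_nonneg y) (sub_nonneg.2 h2), mul_nonneg (sq_nonneg y) h1,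
    mul_le_mul_of_nonneg_left (mul_le_mul h2 h2 h1 zero_le_one) (sq_nonneg y)]

/-- Approximate detailed balance of transition amplitudes. -/
lemma sq_sqrt_mul_sqrt_sub_le {g g' p q β ω ν : ℝ} (hβ : 0 ≤ β) (hg : 0 ≤ g ∧ g ≤ 1)
    (hg' : 0 ≤ g' ∧ g' ≤ 1) (hp : 0 ≤ p) (hq : 0 ≤ q) (hgg : g = Real.exp (-β * ω) * g')
    (hpq : p = Real.exp (-β * ν) * q) :
    (√g' * √p - √g * √q) ^ 2
      ≤ (p + q) * (2 * (β / 2 * (ω - ν)) ^ 2 / (1 + (β / 2 * (ω - ν)) ^ 2)) := by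
  set y := β / 2 * (ω - ν) with hy
  have e1 : √g = Real.exp (-β * ω / 2) * √g' := by
    rw [hgg, Real.sqrt_mul (Real.exp_pos _).le, Real.exp_half]
  have e2 : √p = Real.exp (-β * ν / 2) * √q := by
    rw [hpq, Real.sqrt_mul (Real.exp_pos _).le, Real.exp_half]
  have hm : 0 ≤ 2 * y ^ 2 / (1 + y ^ 2) := by positivity
  -- By KMS and the Gibbs ratio the two amplitudes differ by the factor `exp (-y)`. The larger one
  -- is factored out, so that the exponent is nonpositive; its square is at most `p` or `q`.
  rcases le_total ν ω with h | h
  · have hy0 : 0 ≤ y := mul_nonneg (by linarith) (sub_nonneg.2 h)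
    have e : √g * √q = √g' * √p * Real.exp (-y) := by
      rw [e1, e2]
      have : Real.exp (-β * ω / 2) = Real.exp (-β * ν / 2) * Real.exp (-y) := by
        rw [← Real.exp_add]; congr 1; rw [hy]; ring
      rw [this]; ring
    have : (√g' * √p - √g * √q) ^ 2 = g' * p * (1 - Real.exp (-y)) ^ 2 := by
      rw [e]
      calc _ = √g' ^ 2 * √p ^ 2 * (1 - Real.exp (-y)) ^ 2 := by ring
        _ = _ := by rw [Real.sq_sqrt hg'.1, Real.sq_sqrt hp]
    rw [this]
    refine mul_le_mul ?_ (one_sub_exp_neg_sq_le hy0) (sq_nonneg _) (by linarith)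
    nlinarith
  · have hy0 : 0 ≤ -y := by
      rw [hy]
      nlinarith
    have e : √g' * √p = √g * √q * Real.exp (-(-y)) := by
      rw [e1, e2]
      have : Real.exp (-β * ν / 2) = Real.exp (-β * ω / 2) * Real.exp (-(-y)) := by
        rw [← Real.exp_add]; congr 1; rw [hy]; ring
      rw [this]; ring
    have : (√g' * √p - √g * √q) ^ 2 = g * q * (1 - Real.exp (-(-y))) ^ 2 := by
      rw [e]
      calc _ = √g ^ 2 * √q ^ 2 * (1 - Real.exp (-(-y))) ^ 2 := by ring
        _ = _ := by rw [Real.sq_sqrt hg.1, Real.sq_sqrt hq]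
    rw [this]
    have h1 := one_sub_exp_neg_sq_le hy0
    rw [neg_sq] at h1
    refine mul_le_mul ?_ h1 (sq_nonneg _) (by linarith)
    nlinarith

lemma integrable_lorentzian (β c ν : ℝ) (hβ : 0 ≤ β) :
    Integrable fun ω : ℝ => β ^ 2 * c * (1 + (β / 2 * (ω - ν)) ^ 2)⁻¹ := by
  rcases hβ.eq_or_lt with rfl | hβ
  · simp
  · exact ((integrable_inv_one_add_sq.comp_mul_left' (by positivity : β / 2 ≠ 0)).comp_sub_right
      ν).const_mul _

lemma integral_lorentzian (β c ν : ℝ) (hβ : 0 ≤ β) :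
    ∫ ω : ℝ, β ^ 2 * c * (1 + (β / 2 * (ω - ν)) ^ 2)⁻¹ = 2 * Real.pi * β * c := by
  rcases hβ.eq_or_lt with rfl | hβ
  · simp
  · rw [integral_const_mul,
      integral_sub_right_eq_self (fun ω : ℝ => (1 + (β / 2 * ω) ^ 2)⁻¹) ν,
      Measure.integral_comp_mul_left (fun x : ℝ => (1 + x ^ 2)⁻¹),
      integral_univ_inv_one_add_sq, abs_of_pos (by positivity), smul_eq_mul]
    field_simp

variable {n : Type*} [Fintype n] [DecidableEq n]

/-- Gibbs weights. -/
noncomputable def gibbsWeight (β : ℝ) (E : n → ℝ) (i : n) : ℝ :=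
  Real.exp (-β * E i) / ∑ k, Real.exp (-β * E k)

omit [DecidableEq n] in
lemma gibbsWeight_nonneg (β : ℝ) (E : n → ℝ) (i : n) : 0 ≤ gibbsWeight β E i := by
  unfold gibbsWeight; positivity

omit [DecidableEq n] in
lemma gibbsWeight_eq (β : ℝ) (E : n → ℝ) (i j : n) :
    gibbsWeight β E i = Real.exp (-β * (E i - E j)) * gibbsWeight β E j := by
  unfold gibbsWeight
  rw [← mul_div_assoc, ← Real.exp_add]
  congr 2
  ring

/-- The square root of the Gibbs state, in a diagonalising basis. -/
noncomputable def gibbsRoot (β : ℝ) (V : Matrix n n ℂ) (E : n → ℝ) : Matrix n n ℂ :=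
  V * diagonal (fun i => ((√(gibbsWeight β E i) : ℝ) : ℂ)) * Vᴴ

lemma gibbsRoot_conjTranspose (β : ℝ) (V : Matrix n n ℂ) (E : n → ℝ) :
    (gibbsRoot β V E)ᴴ = gibbsRoot β V E := by
  unfold gibbsRoot
  rw [conjTranspose_mul, conjTranspose_mul, conjTranspose_conjTranspose, diagonal_conjTranspose,
    ← Matrix.mul_assoc]
  congr 3
  ext i
  simp

section Gibbs

variable {V H : Matrix n n ℂ} {E : n → ℝ}

lemma gibbsState_eq (hV : Vᴴ * V = 1) (hd : H = V * diagonal (fun i => (E i : ℂ)) * Vᴴ) (β : ℝ) :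
    gibbsState β H = V * diagonal (fun i => (gibbsWeight β E i : ℂ)) * Vᴴ := by
  have e : ∀ i, Complex.exp (-(β : ℂ) * E i) = ((Real.exp (-β * E i) : ℝ) : ℂ) := fun i => by
    push_cast; rfl
  rw [gibbsState, hd, exp_smul_conj_diagonal hV, trace_conj_unitary hV, trace_diagonal,
    ← smul_mul_assoc, ← mul_smul_comm, ← diagonal_smul]
  congr 3
  ext i
  simp only [e, Pi.smul_apply, smul_eq_mul, gibbsWeight]
  push_cast
  rw [div_eq_inv_mul]

lemma gibbsRoot_mul_self (hV : Vᴴ * V = 1) (hd : H = V * diagonal (fun i => (E i : ℂ)) * Vᴴ)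
    (β : ℝ) : gibbsRoot β V E * gibbsRoot β V E = gibbsState β H := by
  rw [gibbsState_eq hV hd, gibbsRoot]
  calc _ = V * (diagonal (fun i => ((√(gibbsWeight β E i) : ℝ) : ℂ)) * (Vᴴ * V) *
        diagonal (fun i => ((√(gibbsWeight β E i) : ℝ) : ℂ))) * Vᴴ := by
        simp only [Matrix.mul_assoc]
    _ = _ := by
        rw [hV, Matrix.mul_one, diagonal_mul_diagonal]
        congr 3
        ext i
        rw [← Complex.ofReal_mul, Real.mul_self_sqrt (gibbsWeight_nonneg β E i)]

lemma isState_gibbsState [Nonempty n] (hH : H.IsHermitian) (β : ℝ) :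
    IsState (gibbsState β H) := by
  obtain ⟨V, hV, -, hd⟩ := exists_unitary_diagonal hH
  constructor
  · rw [← gibbsRoot_mul_self hV hd]
    nth_rewrite 1 [← gibbsRoot_conjTranspose]
    exact posSemidef_conjTranspose_mul_self _
  · rw [gibbsState_eq hV hd, trace_conj_unitary hV, trace_diagonal, ← Complex.ofReal_sum]
    simp only [gibbsWeight]
    rw [← Finset.sum_div, div_self, Complex.ofReal_one]
    exact (Finset.sum_pos (fun i _ => Real.exp_pos _) Finset.univ_nonempty).ne'

lemma hsSq_gibbsRoot [Nonempty n] (hH : H.IsHermitian) (hV : Vᴴ * V = 1)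
    (hd : H = V * diagonal (fun i => (E i : ℂ)) * Vᴴ) (β : ℝ) : hsSq (gibbsRoot β V E) = 1 := by
  have h := hsSq_eq_trace (gibbsRoot β V E)
  rw [gibbsRoot_conjTranspose, gibbsRoot_mul_self hV hd, (isState_gibbsState hH β).2] at h
  exact_mod_cast h

lemma conj_gibbsRoot_mul (hV : Vᴴ * V = 1) (β : ℝ) (K : Matrix n n ℂ) (i j : n) :
    (Vᴴ * (gibbsRoot β V E * K) * V) i j = (√(gibbsWeight β E i) : ℝ) * (Vᴴ * K * V) i j := by
  have : Vᴴ * (gibbsRoot β V E * K) * V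
      = (Vᴴ * V) * diagonal (fun i => ((√(gibbsWeight β E i) : ℝ) : ℂ)) * (Vᴴ * K * V) := by
    unfold gibbsRoot; simp only [Matrix.mul_assoc]
  rw [this, hV, Matrix.one_mul, diagonal_mul]

lemma conj_mul_gibbsRoot (hV : Vᴴ * V = 1) (β : ℝ) (K : Matrix n n ℂ) (i j : n) :
    (Vᴴ * (K * gibbsRoot β V E) * V) i j = (Vᴴ * K * V) i j * (√(gibbsWeight β E j) : ℝ) := by
  have : Vᴴ * (K * gibbsRoot β V E) * V
      = (Vᴴ * K * V) * diagonal (fun i => ((√(gibbsWeight β E i) : ℝ) : ℂ)) * (Vᴴ * V) := by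
    unfold gibbsRoot; simp only [Matrix.mul_assoc]
  rw [this, hV, Matrix.mul_one, mul_diagonal]

lemma hsSq_conj (hV' : V * Vᴴ = 1) (M : Matrix n n ℂ) : hsSq (Vᴴ * M * V) = hsSq M := by
  rw [hsSq_mul_unitary hV', hsSq_unitary_mul (by simpa using hV')]

lemma sum_gibbsWeight_left (hV : Vᴴ * V = 1) (hV' : V * Vᴴ = 1) (β : ℝ) (K : Matrix n n ℂ) :
    ∑ i, ∑ j, gibbsWeight β E i * ‖(Vᴴ * K * V) i j‖ ^ 2 = hsSq (gibbsRoot β V E * K) := by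
  rw [← hsSq_conj hV', hsSq]
  refine Finset.sum_congr rfl fun i _ => Finset.sum_congr rfl fun j _ => ?_
  rw [conj_gibbsRoot_mul hV, norm_mul, mul_pow, Complex.norm_real, Real.norm_eq_abs, sq_abs,
    Real.sq_sqrt (gibbsWeight_nonneg β E i)]

lemma sum_gibbsWeight_right (hV : Vᴴ * V = 1) (hV' : V * Vᴴ = 1) (β : ℝ) (K : Matrix n n ℂ) :
    ∑ i, ∑ j, gibbsWeight β E j * ‖(Vᴴ * K * V) i j‖ ^ 2 = hsSq (K * gibbsRoot β V E) := by
  rw [← hsSq_conj hV', hsSq]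
  refine Finset.sum_congr rfl fun i _ => Finset.sum_congr rfl fun j _ => ?_
  rw [conj_mul_gibbsRoot hV, norm_mul, mul_pow, Complex.norm_real, Real.norm_eq_abs, sq_abs,
    Real.sq_sqrt (gibbsWeight_nonneg β E j), mul_comm]

/-- Pointwise bound on the violation of detailed balance by a single jump operator. -/
lemma hsSq_detailedBalance_le (hH : H.IsHermitian) (hV : Vᴴ * V = 1) (hV' : V * Vᴴ = 1)
    (hd : H = V * diagonal (fun i => (E i : ℂ)) * Vᴴ) {β T : ℝ} (hβ : 0 ≤ β) (hT : 0 < T)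
    (A : Matrix n n ℂ) {g g' ω : ℝ} (hg : 0 ≤ g ∧ g ≤ 1)
    (hg' : 0 ≤ g' ∧ g' ≤ 1) (hgg : g = Real.exp (-β * ω) * g') :
    hsSq (((√g' : ℝ) : ℂ) • (gibbsRoot β V E * operatorFourier (windowFilter T) H A ω)
        - ((√g : ℝ) : ℂ) • (operatorFourier (windowFilter T) H A ω * gibbsRoot β V E))
      ≤ ∑ i, ∑ j, (gibbsWeight β E i + gibbsWeight β E j) * ‖(Vᴴ * A * V) i j‖ ^ 2 *
        (β ^ 2 * (1 / (Real.pi * T)) * (1 + (β / 2 * (ω - (E i - E j))) ^ 2)⁻¹) := by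
  set K := operatorFourier (windowFilter T) H A ω with hK
  set R := gibbsRoot β V E
  rw [← hsSq_conj hV', hsSq]
  refine Finset.sum_le_sum fun i _ => Finset.sum_le_sum fun j _ => ?_
  have hdecay := norm_sq_conj_operatorFourier_apply_mul_le hH hT hV hd A ω i j
  rw [← hK] at hdecay
  have e : (Vᴴ * (((√g' : ℝ) : ℂ) • (R * K) - ((√g : ℝ) : ℂ) • (K * R)) * V) i j
      = (Vᴴ * K * V) i j * ((√g' * √(gibbsWeight β E i) - √g * √(gibbsWeight β E j) : ℝ) : ℂ) := by
    rw [Matrix.mul_sub, Matrix.sub_mul, Matrix.sub_apply, Matrix.mul_smul, Matrix.mul_smul,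
      Matrix.smul_mul, Matrix.smul_mul, Matrix.smul_apply, Matrix.smul_apply,
      conj_gibbsRoot_mul hV, conj_mul_gibbsRoot hV, smul_eq_mul, smul_eq_mul]
    push_cast
    ring
  rw [e, norm_mul, mul_pow, Complex.norm_real, Real.norm_eq_abs, sq_abs]
  have h1 := sq_sqrt_mul_sqrt_sub_le hβ hg hg' (gibbsWeight_nonneg β E i)
    (gibbsWeight_nonneg β E j) hgg (gibbsWeight_eq β E i j)
  set x := ω - (E i - E j)
  set P := gibbsWeight β E i + gibbsWeight β E j
  have hP : 0 ≤ P := add_nonneg (gibbsWeight_nonneg β E i) (gibbsWeight_nonneg β E j)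
  have hpi := Real.pi_pos
  -- The factor `x²` in the amplitude bound is handed to the decay estimate, which trades it for `2
  -- / (π T)`; with `2 (β / 2)² = β² / 2` this yields `β² / (π T)`.
  calc _ ≤ ‖(Vᴴ * K * V) i j‖ ^ 2 * (P * (2 * (β / 2 * x) ^ 2 / (1 + (β / 2 * x) ^ 2))) := by
        gcongr
    _ = (‖(Vᴴ * K * V) i j‖ ^ 2 * x ^ 2) * (P * (β ^ 2 / 2) * (1 + (β / 2 * x) ^ 2)⁻¹) := by
        field_simp
    _ ≤ (2 / (Real.pi * T) * ‖(Vᴴ * A * V) i j‖ ^ 2) *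
        (P * (β ^ 2 / 2) * (1 + (β / 2 * x) ^ 2)⁻¹) := by gcongr
    _ = _ := by
        field_simp

end Gibbs

/-- Pointwise estimate of the symmetrised generator in terms of the detailed balance defect
`b R K - a K R`. -/
lemma norm_trace_symmetrized_le {δ a b : ℝ} (hδ : 0 < δ) (ha : 0 ≤ a ∧ a ≤ 1)
    (hb : 0 ≤ b ∧ b ≤ 1) {Z : Matrix n n ℂ} (hZ : ‖Z‖ ≤ 1) {R : Matrix n n ℂ} (hR : Rᴴ = R)
    (K : Matrix n n ℂ) :
    ‖((b ^ 2 : ℝ) : ℂ) * (Z * (Kᴴ * (R * R) * K)).trace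
        - ((a ^ 2 : ℝ) : ℂ) * (1 / 2 * (Z * (Kᴴ * K * (R * R) + R * R * (Kᴴ * K))).trace)‖
      ≤ δ / 4 * (2 * hsSq (Kᴴ * R) + hsSq (K * (Zᴴ * R)) + hsSq (K * (Z * R)))
        + 1 / δ * hsSq ((b : ℂ) • (R * K) - (a : ℂ) • (K * R)) := by
  set U := (b : ℂ) • (R * K) with hU
  set D := U - (a : ℂ) • (K * R) with hD
  have hUH : Uᴴ = (b : ℂ) • (Kᴴ * R) := by
    rw [hU, conjTranspose_smul, conjTranspose_mul, hR]; simp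
  have hDH : Dᴴ = (b : ℂ) • (Kᴴ * R) - (a : ℂ) • (R * Kᴴ) := by
    rw [hD, conjTranspose_sub, hUH, conjTranspose_smul, conjTranspose_mul, hR]; simp
  have t1 : ((U * Zᴴ)ᴴ * D).trace = (Z * (Uᴴ * D)).trace := by
    rw [conjTranspose_mul, conjTranspose_conjTranspose, Matrix.mul_assoc]
  have t2 : (((a : ℂ) • (K * (Zᴴ * R)))ᴴ * D).trace = (Z * ((a : ℂ) • (Kᴴ * D * R))).trace := by
    rw [conjTranspose_smul, conjTranspose_mul, conjTranspose_mul, conjTranspose_conjTranspose, hR,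
      smul_mul_assoc, trace_smul, mul_smul_comm, trace_smul, Matrix.mul_assoc R Z,
      Matrix.mul_assoc R, Matrix.trace_mul_comm R]
    simp [Matrix.mul_assoc]
  have t3 : (Dᴴ * (U * Z)).trace = (Z * (Dᴴ * U)).trace := by
    rw [← Matrix.mul_assoc, Matrix.trace_mul_comm]
  have t4 : (Dᴴ * ((a : ℂ) • (K * (Z * R)))).trace = (Z * ((a : ℂ) • (R * Dᴴ * K))).trace := by
    rw [mul_smul_comm, trace_smul, mul_smul_comm, trace_smul, ← Matrix.mul_assoc,
      ← Matrix.mul_assoc, Matrix.trace_mul_comm _ R, ← Matrix.mul_assoc, ← Matrix.mul_assoc,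
      Matrix.trace_mul_comm _ Z]
  -- With `U = b R K` and `D = U - a K R`, twice gain minus loss equals `U† D + a K† D R` plus its
  -- adjoint: the cross terms `a b K† R K R` cancel. Each term contains `D` exactly once.
  have key : ((b ^ 2 : ℝ) : ℂ) * (Z * (Kᴴ * (R * R) * K)).trace
        - ((a ^ 2 : ℝ) : ℂ) * (1 / 2 * (Z * (Kᴴ * K * (R * R) + R * R * (Kᴴ * K))).trace)
      = 1 / 2 * (((U * Zᴴ)ᴴ * D).trace + (((a : ℂ) • (K * (Zᴴ * R)))ᴴ * D).trace
        + (Dᴴ * (U * Z)).trace + (Dᴴ * ((a : ℂ) • (K * (Z * R)))).trace) := by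
    rw [t1, t2, t3, t4, ← trace_add, ← trace_add, ← trace_add, ← Matrix.mul_add, ← Matrix.mul_add,
      ← Matrix.mul_add]
    have : Uᴴ * D + (a : ℂ) • (Kᴴ * D * R) + Dᴴ * U + (a : ℂ) • (R * Dᴴ * K)
        = (2 * (b : ℂ) ^ 2) • (Kᴴ * (R * R) * K)
          - ((a : ℂ) ^ 2) • (Kᴴ * K * (R * R) + R * R * (Kᴴ * K)) := by
      rw [hUH, hDH, hD, hU]
      simp only [Matrix.sub_mul, Matrix.mul_sub, smul_mul_assoc, mul_smul_comm, smul_sub, smul_add,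
        smul_smul, Matrix.mul_assoc]
      module
    rw [this, Matrix.mul_sub, mul_smul_comm, mul_smul_comm, trace_sub, trace_smul, trace_smul,
      smul_eq_mul, smul_eq_mul]
    push_cast
    ring
  have sq_le : ∀ c : ℝ, 0 ≤ c ∧ c ≤ 1 → ∀ M : Matrix n n ℂ, hsSq ((c : ℂ) • M) ≤ hsSq M := by
    intro c hc M
    rw [hsSq_smul, Complex.norm_real, Real.norm_of_nonneg hc.1]
    exact mul_le_of_le_one_left (hsSq_nonneg _) (pow_le_one₀ hc.1 hc.2)
  have hUle : hsSq U ≤ hsSq (Kᴴ * R) := by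
    refine (sq_le b hb _).trans_eq ?_
    rw [← hsSq_conjTranspose, conjTranspose_mul, hR]
  have hUZ : ∀ W : Matrix n n ℂ, ‖W‖ ≤ 1 → hsSq (U * W) ≤ hsSq (Kᴴ * R) := fun W hW =>
    (hsSq_mul_le' U W).trans ((mul_le_of_le_one_left (hsSq_nonneg _)
      (pow_le_one₀ (norm_nonneg _) hW)).trans hUle)
  have hZ' : ‖Zᴴ‖ ≤ 1 := by rwa [Matrix.l2_opNorm_conjTranspose]
  have swap : ∀ X : Matrix n n ℂ, ‖(Dᴴ * X).trace‖ ≤ δ / 2 * hsSq X + 1 / (2 * δ) * hsSq D := by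
    intro X
    have h := norm_trace_conjTranspose_mul_le hδ X D
    have e : (Dᴴ * X).trace = star (Xᴴ * D).trace := by
      rw [← trace_conjTranspose, conjTranspose_mul, conjTranspose_conjTranspose]
    rwa [e, norm_star]
  have b1 := norm_trace_conjTranspose_mul_le hδ (U * Zᴴ) D
  have b2 := norm_trace_conjTranspose_mul_le hδ ((a : ℂ) • (K * (Zᴴ * R))) D
  have b3 := swap (U * Z)
  have b4 := swap ((a : ℂ) • (K * (Z * R)))
  have c1 := mul_le_mul_of_nonneg_left (hUZ Zᴴ hZ') (by positivity : 0 ≤ δ / 2)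
  have c2 := mul_le_mul_of_nonneg_left (sq_le a ha (K * (Zᴴ * R))) (by positivity : 0 ≤ δ / 2)
  have c3 := mul_le_mul_of_nonneg_left (hUZ Z hZ) (by positivity : 0 ≤ δ / 2)
  have c4 := mul_le_mul_of_nonneg_left (sq_le a ha (K * (Z * R))) (by positivity : 0 ≤ δ / 2)
  rw [key, norm_mul]
  have hhalf : ‖(1 / 2 : ℂ)‖ = 1 / 2 := by norm_num
  rw [hhalf]
  have n1 := norm_add_le (((U * Zᴴ)ᴴ * D).trace + (((a : ℂ) • (K * (Zᴴ * R)))ᴴ * D).trace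
        + (Dᴴ * (U * Z)).trace) ((Dᴴ * ((a : ℂ) • (K * (Z * R)))).trace)
  have n2 := norm_add₃_le (a := ((U * Zᴴ)ᴴ * D).trace)
    (b := (((a : ℂ) • (K * (Zᴴ * R)))ᴴ * D).trace) (c := (Dᴴ * (U * Z)).trace)
  have hδ' : 1 / (2 * δ) = 1 / δ / 2 := by field_simp
  rw [hδ'] at b1 b2 b3 b4
  linarith

end OpenSystem

/-! ### Near-stationarity of the Gibbs state -/

namespace OpenSystem

open Matrix

open MeasureTheory

section NearStationarity

variable {n ι : Type*} [Fintype n] [DecidableEq n] [Fintype ι]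

variable {H : Matrix n n ℂ} {A : ι → Matrix n n ℂ} {γ : ℝ → ℝ} {β T : ℝ} {σ : Equiv.Perm ι}

omit [DecidableEq n] in
lemma sum_conjTranspose_perm (hσ : ∀ a, A (σ a) = (A a)ᴴ) :
    ∑ a, ((A a)ᴴ)ᴴ * (A a)ᴴ = ∑ a, (A a)ᴴ * A a := by
  rw [← Equiv.sum_comp σ fun a => (A a)ᴴ * A a]
  exact Finset.sum_congr rfl fun a _ => by rw [hσ]

/-- The trace of the generator, rewritten with the gain term in its time-reversed form. -/
lemma trace_mul_lindbladian_apply (hH : H.IsHermitian) (hT : 0 < T) (hγm : Measurable γ)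
    (hγ : ∀ ω, 0 ≤ γ ω ∧ γ ω ≤ 1) (hσ : ∀ a, A (σ a) = (A a)ᴴ) (Z X : Matrix n n ℂ) :
    (Z * lindbladian (windowFilter T) γ H A X).trace
      = ∑ a, ∫ ω, ((γ (-ω) : ℂ) * (Z * ((operatorFourier (windowFilter T) H (A a) ω)ᴴ * X *
            operatorFourier (windowFilter T) H (A a) ω)).trace
          - (γ ω : ℂ) * (1 / 2 * (Z * ((operatorFourier (windowFilter T) H (A a) ω)ᴴ *
            operatorFourier (windowFilter T) H (A a) ω * X + X *
            ((operatorFourier (windowFilter T) H (A a) ω)ᴴ *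
            operatorFourier (windowFilter T) H (A a) ω))).trace)) := by
  set K : ι → ℝ → Matrix n n ℂ := fun a => operatorFourier (windowFilter T) H (A a) with hK
  have hKneg : ∀ a ω, K a (-ω) = (K (σ a) ω)ᴴ := fun a ω => by
    rw [hK]
    simp only
    rw [operatorFourier_conjTranspose hH hT, hσ, conjTranspose_conjTranspose]
  have hγm' : Measurable fun ω => γ (-ω) := hγm.comp measurable_neg
  have hgain_norm : ∀ M : Matrix n n ℂ, ‖M * X * Mᴴ‖ ≤ ‖X‖ * ‖M‖ ^ 2 := fun M =>
    norm_mul_mul_conjTranspose_le M X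
  have h0 : Continuous fun M : Matrix n n ℂ => Mᴴ * M :=
    continuous_id.matrix_conjTranspose.matrix_mul continuous_id
  let τ : Matrix n n ℂ →L[ℂ] ℂ := LinearMap.toContinuousLinearMap
    (Matrix.traceLinearMap n ℂ ℂ ∘ₗ LinearMap.mulLeft ℂ Z)
  have hτ : ∀ M, τ M = (Z * M).trace := fun M => rfl
  let η : Matrix n n ℂ →L[ℂ] ℂ := LinearMap.toContinuousLinearMap
    ((1 / 2 : ℂ) • (Matrix.traceLinearMap n ℂ ℂ ∘ₗ LinearMap.mulLeft ℂ Z ∘ₗ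
      (LinearMap.mulRight ℂ X + LinearMap.mulLeft ℂ X)))
  have hη : ∀ M, η M = 1 / 2 * (Z * (M * X + X * M)).trace := fun M => rfl
  have i0 : ∀ a, Integrable fun ω => (γ ω : ℂ) • dissipator (K a ω) X := fun a =>
    (((LinearMap.toContinuousLinearMap (E := Matrix n n ℂ →L[ℂ] Matrix n n ℂ) (𝕜 := ℂ)
      (LinearMap.applyₗ X ∘ₗ ContinuousLinearMap.coeLM ℂ)).integrable_comp
      (integrable_smul_comp_operatorFourier (F := Matrix n n ℂ →L[ℂ] Matrix n n ℂ)
      (B := dissipator) hH hT hγm hγ (A a) continuous_dissipator norm_dissipator_le)) : _)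
  have i1 : ∀ a, Integrable fun ω => (γ ω : ℂ) • τ (K a ω * X * (K a ω)ᴴ) := fun a => by
    have := τ.integrable_comp (integrable_smul_comp_operatorFourier (B := fun M => M * X * Mᴴ)
      hH hT hγm hγ (A a) (by fun_prop) hgain_norm)
    simpa only [map_smul] using this
  have i1' : ∀ a, Integrable fun ω => (γ (-ω) : ℂ) • τ ((K a ω)ᴴ * X * K a ω) := fun a => by
    have := τ.integrable_comp (integrable_smul_comp_operatorFourier (B := fun M => Mᴴ * X * M)
      hH hT hγm' (fun ω => hγ (-ω)) (A a) (by fun_prop) (c := ‖X‖) fun M => by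
        have := norm_mul_mul_conjTranspose_le Mᴴ X
        rwa [conjTranspose_conjTranspose, Matrix.l2_opNorm_conjTranspose] at this)
    simpa only [map_smul] using this
  have i2 : ∀ a, Integrable fun ω => (γ ω : ℂ) • η ((K a ω)ᴴ * K a ω) := fun a => by
    have := η.integrable_comp (integrable_smul_comp_operatorFourier (B := fun M => Mᴴ * M)
      hH hT hγm hγ (A a) h0 norm_conjTranspose_mul_self_le)
    simpa only [map_smul] using this
  have hsplit : ∀ a, τ (∫ ω, (γ ω : ℂ) • dissipator (K a ω) X)
      = (∫ ω, (γ ω : ℂ) • τ (K a ω * X * (K a ω)ᴴ)) - ∫ ω, (γ ω : ℂ) • η ((K a ω)ᴴ * K a ω) := by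
    intro a
    rw [← integral_sub (i1 a) (i2 a), ← ContinuousLinearMap.integral_comp_comm τ (i0 a)]
    refine integral_congr_ae (Filter.Eventually.of_forall fun ω => ?_)
    simp only
    rw [← smul_sub, map_smul, dissipator_apply, map_sub, map_smul, hη, hτ, hτ]
    rfl
  -- Reflecting the frequency replaces each jump operator by the adjoint of its partner `σ a`;
  -- relabelling by `σ` in the sum over jumps then removes `σ`.
  have hrev : ∀ a, ∫ ω, (γ ω : ℂ) • τ (K a ω * X * (K a ω)ᴴ)
      = ∫ ω, (γ (-ω) : ℂ) • τ ((K (σ a) ω)ᴴ * X * K (σ a) ω) := by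
    intro a
    rw [← integral_neg_eq_self]
    simp only [hKneg, conjTranspose_conjTranspose]
  rw [lindbladian_apply hH hT hγm hγ, ← hτ, map_sum]
  calc ∑ a, τ (∫ ω, (γ ω : ℂ) • dissipator (K a ω) X)
      = ∑ a, ((∫ ω, (γ (-ω) : ℂ) • τ ((K (σ a) ω)ᴴ * X * K (σ a) ω))
          - ∫ ω, (γ ω : ℂ) • η ((K a ω)ᴴ * K a ω)) := by simp only [hsplit, hrev]
    _ = ∑ a, ((∫ ω, (γ (-ω) : ℂ) • τ ((K a ω)ᴴ * X * K a ω))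
          - ∫ ω, (γ ω : ℂ) • η ((K a ω)ᴴ * K a ω)) := by
        rw [Finset.sum_sub_distrib, Finset.sum_sub_distrib,
          Equiv.sum_comp σ fun a => ∫ ω, (γ (-ω) : ℂ) • τ ((K a ω)ᴴ * X * K a ω)]
    _ = _ := by
        refine Finset.sum_congr rfl fun a _ => ?_
        rw [← integral_sub (i1' a) (i2 a)]
        rfl

/-- The Gibbs state is nearly stationary for the coarse-grained master equation. -/
lemma traceNorm_lindbladian_gibbsState_le [Nonempty n] (hβ : 0 ≤ β) (hT : 0 < T)
    (hH : H.IsHermitian) (hσ : ∀ a, A (σ a) = (A a)ᴴ) (hA : ‖∑ a, (A a)ᴴ * A a‖ ≤ 1)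
    (hγm : Measurable γ) (hkms : ∀ ω, γ ω = Real.exp (-β * ω) * γ (-ω))
    (hγ : ∀ ω, 0 ≤ γ ω ∧ γ ω ≤ 1) {δ : ℝ} (hδ : 0 < δ) :
    traceNorm (lindbladian (windowFilter T) γ H A (gibbsState β H))
      ≤ δ + 1 / δ * (4 * (β / T)) := by
  obtain ⟨V, hV, hV', hd⟩ := exists_unitary_diagonal hH
  set E := hH.eigenvalues
  set R := gibbsRoot β V E with hRdef
  have hR : Rᴴ = R := gibbsRoot_conjTranspose β V E
  have hR1 : hsSq R = 1 := hsSq_gibbsRoot hH hV hd β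
  have hA' : ‖∑ a, ((A a)ᴴ)ᴴ * (A a)ᴴ‖ ≤ 1 := by rwa [sum_conjTranspose_perm hσ]
  set K : ι → ℝ → Matrix n n ℂ := fun a => operatorFourier (windowFilter T) H (A a) with hK
  refine traceNorm_le_of_forall fun Z hZ => ?_
  set G : ι → ℝ → ℝ := fun a ω => ∑ i, ∑ j,
    (gibbsWeight β E i + gibbsWeight β E j) * ‖(Vᴴ * A a * V) i j‖ ^ 2 *
        (β ^ 2 * (1 / (Real.pi * T)) * (1 + (β / 2 * (ω - (E i - E j))) ^ 2)⁻¹) with hG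
  have iG : ∀ a, Integrable (G a) := fun a =>
    integrable_finsetSum _ fun i _ => integrable_finsetSum _ fun j _ =>
      (integrable_lorentzian β _ _ hβ).const_mul _
  -- Each Lorentzian integrates to `2 β / T`. The Gibbs weights turn the entries into `‖R A‖²` and
  -- `‖A R‖²` in Hilbert–Schmidt norm, and each of these sums over jumps to at most one.
  have hGint : ∑ a, ∫ ω, G a ω ≤ 4 * (β / T) := by
    have e : ∀ a, ∫ ω, G a ω = 2 * (β / T) * (hsSq ((A a)ᴴ * R) + hsSq (A a * R)) := by
      intro a
      rw [← hsSq_conjTranspose ((A a)ᴴ * R), conjTranspose_mul, conjTranspose_conjTranspose, hR,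
        hRdef, ← sum_gibbsWeight_left hV hV', ← sum_gibbsWeight_right hV hV',
        ← Finset.sum_add_distrib, Finset.mul_sum, hG,
        integral_finsetSum _ fun i _ => integrable_finsetSum _ fun j _ =>
          (integrable_lorentzian β _ _ hβ).const_mul _]
      refine Finset.sum_congr rfl fun i _ => ?_
      rw [integral_finsetSum _ fun j _ => (integrable_lorentzian β _ _ hβ).const_mul _,
        ← Finset.sum_add_distrib, Finset.mul_sum]
      refine Finset.sum_congr rfl fun j _ => ?_
      rw [integral_const_mul, integral_lorentzian β _ _ hβ]
      field_simp
    simp only [e]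
    rw [← Finset.mul_sum, Finset.sum_add_distrib]
    have h1 := sum_hsSq_mul_le hA R
    have h2 := sum_hsSq_mul_le hA' R
    rw [hR1] at h1 h2
    have : 0 ≤ β / T := by positivity
    nlinarith
  have hKH : ∀ a ω, (K a ω)ᴴ = operatorFourier (windowFilter T) H (A a)ᴴ (-ω) := fun a ω =>
    operatorFourier_conjTranspose hH hT (A a) ω
  have iU : ∀ a, Integrable fun ω => hsSq ((K a ω)ᴴ * R) := fun a => by
    simp only [hKH]
    exact (integrable_hsSq_operatorFourier_mul hH hT (A a)ᴴ R).comp_neg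
  have hU : ∑ a, ∫ ω, hsSq ((K a ω)ᴴ * R) ≤ 1 := by
    rw [← hR1]
    refine le_of_eq_of_le (Finset.sum_congr rfl fun a _ => ?_)
      (sum_integral_hsSq_operatorFourier_mul_le hH hT hA' R)
    simp only [hKH]
    exact integral_neg_eq_self
      (fun ω => hsSq (operatorFourier (windowFilter T) H (A a)ᴴ ω * R)) volume
  have iW : ∀ W a, Integrable fun ω => hsSq (K a ω * W) := fun W a =>
    integrable_hsSq_operatorFourier_mul hH hT (A a) W
  have hW : ∀ Y : Matrix n n ℂ, ‖Y‖ ≤ 1 → ∑ a, ∫ ω, hsSq (K a ω * (Y * R)) ≤ 1 := fun Y hY => by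
    refine (sum_integral_hsSq_operatorFourier_mul_le hH hT hA (Y * R)).trans ?_
    refine (hsSq_mul_le Y R).trans ?_
    rw [hR1, mul_one]
    exact pow_le_one₀ (norm_nonneg _) hY
  have hZ' : ‖Zᴴ‖ ≤ 1 := by rwa [Matrix.l2_opNorm_conjTranspose]
  have ib : ∀ a, Integrable fun ω => δ / 4 * (2 * hsSq ((K a ω)ᴴ * R)
      + hsSq (K a ω * (Zᴴ * R)) + hsSq (K a ω * (Z * R))) + 1 / δ * G a ω := fun a =>
    (((((iU a).const_mul 2).add (iW (Zᴴ * R) a)).add (iW (Z * R) a)).const_mul (δ / 4)).add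
      ((iG a).const_mul (1 / δ))
  rw [trace_mul_lindbladian_apply hH hT hγm hγ hσ]
  refine (norm_sum_le _ _).trans ((Finset.sum_le_sum fun a _ =>
    norm_integral_le_of_norm_le (ib a) (Filter.Eventually.of_forall fun ω => ?_)).trans ?_)
  -- The amplitudes are `a = √γ(ω)` for the loss and `b = √γ(-ω)` for the reversed gain, which is
  -- the pair related by KMS.
  · have hs : ∀ ω, 0 ≤ √(γ ω) ∧ √(γ ω) ≤ 1 := fun ω =>
      ⟨Real.sqrt_nonneg _, Real.sqrt_le_one.2 (hγ ω).2⟩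
    have h1 := norm_trace_symmetrized_le hδ (hs ω) (hs (-ω)) hZ hR (K a ω)
    rw [Real.sq_sqrt (hγ ω).1, Real.sq_sqrt (hγ (-ω)).1, hRdef, gibbsRoot_mul_self hV hd,
      ← hRdef] at h1
    refine h1.trans ?_
    have h2 := hsSq_detailedBalance_le hH hV hV' hd hβ hT (A a) (hγ ω) (hγ (-ω)) (hkms ω)
    exact add_le_add_right (mul_le_mul_of_nonneg_left h2 (by positivity)) _
  · have e : ∀ a, ∫ ω, (δ / 4 * (2 * hsSq ((K a ω)ᴴ * R)
        + hsSq (K a ω * (Zᴴ * R)) + hsSq (K a ω * (Z * R))) + 1 / δ * G a ω)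
        = δ / 4 * (2 * (∫ ω, hsSq ((K a ω)ᴴ * R)) + (∫ ω, hsSq (K a ω * (Zᴴ * R)))
          + ∫ ω, hsSq (K a ω * (Z * R))) + 1 / δ * ∫ ω, G a ω := by
      intro a
      have j1 := (iU a).const_mul 2
      have j2 : Integrable fun ω => 2 * hsSq ((K a ω)ᴴ * R) + hsSq (K a ω * (Zᴴ * R)) :=
        j1.add (iW (Zᴴ * R) a)
      have j3 : Integrable fun ω => 2 * hsSq ((K a ω)ᴴ * R) + hsSq (K a ω * (Zᴴ * R))
          + hsSq (K a ω * (Z * R)) := j2.add (iW (Z * R) a)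
      rw [integral_add (j3.const_mul (δ / 4)) ((iG a).const_mul (1 / δ)), integral_const_mul,
        integral_const_mul, integral_add j2 (iW (Z * R) a), integral_add j1 (iW (Zᴴ * R) a),
        integral_const_mul]
    simp only [e]
    rw [Finset.sum_add_distrib, ← Finset.mul_sum, ← Finset.mul_sum, Finset.sum_add_distrib,
      Finset.sum_add_distrib, ← Finset.mul_sum]
    have h1 := hW Zᴴ hZ'
    have h2 := hW Z hZ
    refine add_le_add ?_ (mul_le_mul_of_nonneg_left hGint (by positivity))
    -- Four Plancherel masses, each at most one, against the weight `δ / 4`.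
    calc _ ≤ δ / 4 * (2 * 1 + 1 + 1) := by gcongr
      _ = δ := by ring

end NearStationarity

/-- Take `δ = √q`, which gives `1 + 4`. At `q = 0`, which includes `β = 0`, this choice is not
positive and `δ → 0` is used instead. -/
lemma le_five_mul_sqrt_of_forall {x q : ℝ} (hq : 0 ≤ q)
    (h : ∀ δ : ℝ, 0 < δ → x ≤ δ + 1 / δ * (4 * q)) : x ≤ 5 * √q := by
  rcases hq.eq_or_lt with rfl | hq
  · rw [Real.sqrt_zero, mul_zero]
    refine le_of_forall_pos_le_add fun δ hδ => ?_
    simpa using h δ hδ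
  · have hs := Real.sqrt_pos.2 hq
    refine (h _ hs).trans_eq ?_
    have : 1 / √q * (4 * q) = 4 * √q := by
      rw [one_div, inv_mul_eq_div, div_eq_iff hs.ne', mul_assoc, Real.mul_self_sqrt hq.le]
    rw [this]; ring

end OpenSystem

/-! ### Conclusion -/

theorem theorem1 :
    ∃ C : ℝ, 0 < C ∧
      ∀ (d m : ℕ) (H : Matrix (Fin d) (Fin d) ℂ) (A : Fin m → Matrix (Fin d) (Fin d) ℂ)
        (γ : ℝ → ℝ) (β T : ℝ),
        0 < d → 0 ≤ β → 0 < T →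
        H.IsHermitian →
        -- the family of jump operators is closed under adjoints, and normalized
        (∃ σ : Equiv.Perm (Fin m), ∀ a, A (σ a) = (A a).conjTranspose) →
        ‖∑ a, (A a).conjTranspose * A a‖ ≤ 1 →
        -- the transition weight satisfies the KMS condition, and is normalized
        Measurable γ →
        (∀ ω, γ ω = Real.exp (-β * ω) * γ (-ω)) →
        (∀ ω, 0 ≤ γ ω ∧ γ ω ≤ 1) →
        ∀ tmix : ℝ,
          OpenSystem.IsMixingTime
            (OpenSystem.lindbladian (OpenSystem.windowFilter T) γ H A) tmix →
          ∃ ρfix : Matrix (Fin d) (Fin d) ℂ,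
            OpenSystem.IsFixedState
              (OpenSystem.lindbladian (OpenSystem.windowFilter T) γ H A) ρfix ∧
            (∀ ρ, OpenSystem.IsFixedState
              (OpenSystem.lindbladian (OpenSystem.windowFilter T) γ H A) ρ → ρ = ρfix) ∧
            OpenSystem.traceNorm (ρfix - OpenSystem.gibbsState β H) ≤
              C * (√(β / T) * tmix) := by
  -- The constant is `2 * 5`: two from the perturbation bound, five from near-stationarity.
  refine ⟨10, by norm_num, ?_⟩
  intro d m H A γ β T hd hβ hT hH ⟨σ, hσ⟩ hA hγm hkms hγ t ht
  have : Nonempty (Fin d) := ⟨⟨0, hd⟩⟩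
  obtain ⟨ρ, hρ, huniq, hbound⟩ :=
    (OpenSystem.isLindbladType_lindbladian hH hT hγm hγ A).exists_unique_isFixedState ht
      (OpenSystem.isState_gibbsState hH β)
  refine ⟨ρ, hρ, huniq, hbound.trans ?_⟩
  have h := OpenSystem.le_five_mul_sqrt_of_forall (div_nonneg hβ hT.le) fun δ hδ =>
    OpenSystem.traceNorm_lindbladian_gibbsState_le hβ hT hH hσ hA hγm hkms hγ hδ
  have h2 := mul_le_mul_of_nonneg_left h (mul_nonneg zero_le_two ht.1.1)
  linarith
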